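/- Let $p,q\ge 3$ be integers and let $\mathbb X$ be the sphere $\mathbb S^2$, the Euclidean plane $\mathbb R^2$ or the hyperbolic plane $\mathbb H^2$, according as $\frac1p+\frac1q$ is greater than, equal to or smaller than $\frac12$. Let $F\subset\mathbb X$ be a closed triangle with angles $\frac\pi2,\frac\pi p,\frac\pi q$, and let $$G_{p,q}=\langle a,b,c \mid a^2=b^2=c^2=(ab)^q=(ac)^2=(bc)^p=1\rangle$$ act on $\mathbb X$ by isometries, where $a$, $b$, $c$ act as the reflections in the lines spanned by the sides of $F$ opposite to the angles $\frac\pi p$, $\frac\pi2$, $\frac\pi q$, respectively. Let $T_{p,q}=\{gF : g\in G_{p,q}\}$, and consider the following tilings of $\mathbb X$: the regular tiling $(q^p)$ by the $q$-gons $g\bigcup_{d\in\langle a,b\rangle}dF$, the regular tiling $(p^q)$ by the $p$-gons $g\bigcup_{d\in\langle b,c\rangle}dF$, and the Laves tiling $[p.q.p.q]$ by the quadrilaterals $g\bigcup_{d\in\langle a,c\rangle}dF$, where $g\in G_{p,q}$. Let $k\ge1$. A $k$-colouring of a tiling $\mathcal T$ is a surjective map $d:\mathcal T\to\{1,\dots,k\}$.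 It is perfect (with respect to $G_{p,q}$) if for every $g\in G_{p,q}$ there is a permutation $\pi$ of $\{1,\dots,k\}$ with $d(gP)=\pi(d(P))$ for all $P\in\mathcal T$. A subgroup $S$ of index $k$ in $G_{p,q}$ induces the colouring $d$ of $\mathcal T$ if, for some numbering of the left cosets of $S$ by $1,\dots,k$, the map that assigns to each triangle $gF$ the number of $gS$ is a well-defined colouring of $T_{p,q}$ and every triangle of $T_{p,q}$ contained in a tile $P\in\mathcal T$ has the colour $d(P)$. Then: 1. The group of transformations of $\mathbb X$ given by $G_{p,q}$ is the group of all isometries of $\mathbb X$ that map $(q^p)$ to itself; likewise for $(p^q)$ and, if $p\ne q$, for $[p.q.p.q]$. (So perfect means perfect with respect to the full symmetry group, except for $[p.q.p.q]$ with $p=q$.) 2. Let $S$ be a subgroup of index $k$ in $G_{p,q}$. Then $S$ induces a perfect $k$-colouring of $(q^p)$ if and only if $a,b\in S$; of $(p^q)$ if and only if $b,c\in S$; and of $[p.q.p.q]$ if and only if $a,c\in S$. 3. A map from $(q^p)$ to $\{1,\dots,k\}$ is a perfect $k$-colouring if and only if it is induced by some subgroup $S$ of index $k$ with $a,b\in S$;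 likewise for $(p^q)$ with $b,c\in S$, and for $[p.q.p.q]$ with $a,c\in S$. 4. The stabilisers in $G_{p,q}$ of the vertices of $F$ with angles $\frac\pi q$, $\frac\pi p$, $\frac\pi2$ (a vertex, the centre of a face and the midpoint of an edge of $(p^q)$) are $\langle a,b\rangle$, $\langle b,c\rangle$ and $\langle a,c\rangle$, respectively. -/

import Mathlib

open scoped Pointwise

noncomputable section

namespace PerfectColouring

/-! ### The sphere, the Euclidean plane and the hyperbolic plane -/

/-- The bilinear form `n₀m₀ + n₁m₁ + κ n₂m₂` on normal vectors of lines. -/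
def normalForm (κ : ℝ) (n m : Fin 3 → ℝ) : ℝ := n 0 * m 0 + n 1 * m 1 + κ * (n 2 * m 2)

/-- The value at `v` of the linear form with coefficients `n`. -/
def pairing (n v : Fin 3 → ℝ) : ℝ := n 0 * v 0 + n 1 * v 1 + n 2 * v 2

/-- The plane of constant curvature `κ`, for `κ ∈ {1, 0, -1}`, as the surface
`z² + κ (x² + y²) = 1` in `ℝ³`, with `z > 0` if `κ ≤ 0`. It is the unit sphere for `κ = 1`, the
Euclidean plane `z = 1` for `κ = 0` and the upper sheet of the hyperboloid for `κ = -1`. -/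
def Plane (κ : ℝ) : Type :=
  {v : Fin 3 → ℝ // v 2 ^ 2 + κ * (v 0 ^ 2 + v 1 ^ 2) = 1 ∧ (κ ≤ 0 → 0 < v 2)}

/-- The spherical, Euclidean or hyperbolic distance. -/
def planeDist {κ : ℝ} (x y : Plane κ) : ℝ :=
  if 0 < κ then Real.arccos (x.1 0 * y.1 0 + x.1 1 * y.1 1 + x.1 2 * y.1 2)
  else if κ = 0 then Real.sqrt ((x.1 0 - y.1 0) ^ 2 + (x.1 1 - y.1 1) ^ 2)
  else Real.arcosh (x.1 2 * y.1 2 - x.1 0 * y.1 0 - x.1 1 * y.1 1)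

/-- The group of all isometries of the plane of curvature `κ`. -/
def isometryGroup (κ : ℝ) : Subgroup (Equiv.Perm (Plane κ)) where
  carrier := {f | ∀ x y, planeDist (f x) (f y) = planeDist x y}
  mul_mem' {f g} hf hg x y := by
    rw [Equiv.Perm.mul_apply, Equiv.Perm.mul_apply, hf, hg]
  one_mem' _ _ := rfl
  inv_mem' {f} hf x y := by
    have h := hf (f⁻¹ x) (f⁻¹ y)
    simpa using h.symm

/-! ### Reflections in lines -/

/-- The formula for the reflection in the line `{v | pairing n v = 0}`, where `n` is a unit normal,
that is `normalForm κ n n = 1`. -/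
def reflectVec (κ : ℝ) (n v : Fin 3 → ℝ) : Fin 3 → ℝ :=
  v - (2 * pairing n v) • ![n 0, n 1, κ * n 2]

theorem reflectVec_zero (κ : ℝ) (n v : Fin 3 → ℝ) :
    reflectVec κ n v 0 = v 0 - 2 * pairing n v * n 0 := by simp [reflectVec]

theorem reflectVec_one (κ : ℝ) (n v : Fin 3 → ℝ) :
    reflectVec κ n v 1 = v 1 - 2 * pairing n v * n 1 := by simp [reflectVec]

theorem reflectVec_two (κ : ℝ) (n v : Fin 3 → ℝ) :
    reflectVec κ n v 2 = v 2 - 2 * pairing n v * (κ * n 2) := by simp [reflectVec]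

theorem pairing_reflectVec {κ : ℝ} {n : Fin 3 → ℝ} (hn : normalForm κ n n = 1) (v : Fin 3 → ℝ) :
    pairing n (reflectVec κ n v) = - pairing n v := by
  have h : pairing n (reflectVec κ n v) = pairing n v - 2 * pairing n v * normalForm κ n n := by
    simp only [pairing, normalForm, reflectVec_zero, reflectVec_one, reflectVec_two]; ring
  rw [h, hn]; ring

theorem reflectVec_reflectVec {κ : ℝ} {n : Fin 3 → ℝ} (hn : normalForm κ n n = 1)
    (v : Fin 3 → ℝ) : reflectVec κ n (reflectVec κ n v) = v := by
  have h := pairing_reflectVec hn v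
  rw [reflectVec, h, reflectVec]
  module

theorem reflectVec_mem {κ : ℝ} {n : Fin 3 → ℝ} (hn : normalForm κ n n = 1) {v : Fin 3 → ℝ}
    (hv : v 2 ^ 2 + κ * (v 0 ^ 2 + v 1 ^ 2) = 1 ∧ (κ ≤ 0 → 0 < v 2)) :
    reflectVec κ n v 2 ^ 2 + κ * (reflectVec κ n v 0 ^ 2 + reflectVec κ n v 1 ^ 2) = 1 ∧
      (κ ≤ 0 → 0 < reflectVec κ n v 2) := by
  obtain ⟨hv1, hv2⟩ := hv
  have key : reflectVec κ n v 2 ^ 2 + κ * (reflectVec κ n v 0 ^ 2 + reflectVec κ n v 1 ^ 2) = 1 := by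
    have : reflectVec κ n v 2 ^ 2 + κ * (reflectVec κ n v 0 ^ 2 + reflectVec κ n v 1 ^ 2) =
        (v 2 ^ 2 + κ * (v 0 ^ 2 + v 1 ^ 2)) +
          4 * κ * pairing n v ^ 2 * (normalForm κ n n - 1) := by
      simp only [pairing, normalForm, reflectVec_zero, reflectVec_one, reflectVec_two]; ring
    rw [this, hn, hv1]; ring
  refine ⟨key, fun hκ => ?_⟩
  have hz := hv2 hκ
  by_contra hcon
  push Not at hcon
  set z' := reflectVec κ n v 2 with hz'
  set x' := reflectVec κ n v 0 with hx'
  set y' := reflectVec κ n v 1 with hy'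
  have hprod : v 2 * z' + κ * (v 0 * x' + v 1 * y') = 1 - 2 * κ * pairing n v ^ 2 := by
    have : v 2 * z' + κ * (v 0 * x' + v 1 * y') =
        (v 2 ^ 2 + κ * (v 0 ^ 2 + v 1 ^ 2)) - 2 * κ * pairing n v ^ 2 := by
      rw [hz', hx', hy', reflectVec_zero, reflectVec_one, reflectVec_two]
      simp only [pairing]; ring
    rw [this, hv1]
  have h1 : 1 ≤ v 2 * z' + κ * (v 0 * x' + v 1 * y') := by
    rw [hprod]; nlinarith [mul_nonneg (neg_nonneg.2 hκ) (sq_nonneg (pairing n v))]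
  -- the squares of the two sides contradict the Cauchy-Schwarz inequality
  set s := -κ with hs
  have hs0 : 0 ≤ s := by rw [hs]; linarith
  have hκs : κ = -s := by rw [hs]; ring
  have h2 : 1 + v 2 * (-z') ≤ s * -(v 0 * x' + v 1 * y') := by rw [hκs] at h1; linarith
  have hA : v 2 ^ 2 = 1 + s * (v 0 ^ 2 + v 1 ^ 2) := by rw [hκs] at hv1; linarith
  have hB : z' ^ 2 = 1 + s * (x' ^ 2 + y' ^ 2) := by rw [hκs] at key; linarith
  have hnn : 0 ≤ v 2 * (-z') := mul_nonneg hz.le (by linarith)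
  have hsq : (1 + v 2 * (-z')) ^ 2 ≤ (s * -(v 0 * x' + v 1 * y')) ^ 2 :=
    pow_le_pow_left₀ (by linarith) h2 2
  have hCS : (s * -(v 0 * x' + v 1 * y')) ^ 2 ≤
      (s * (v 0 ^ 2 + v 1 ^ 2)) * (s * (x' ^ 2 + y' ^ 2)) := by
    nlinarith [mul_nonneg (sq_nonneg s) (sq_nonneg (v 0 * y' - v 1 * x'))]
  have hP : 0 ≤ s * (v 0 ^ 2 + v 1 ^ 2) := by positivity
  have hQ : 0 ≤ s * (x' ^ 2 + y' ^ 2) := by positivity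
  have hAB : (v 2 * (-z')) ^ 2 =
      (1 + s * (v 0 ^ 2 + v 1 ^ 2)) * (1 + s * (x' ^ 2 + y' ^ 2)) := by
    rw [← hA, ← hB]; ring
  nlinarith

/-- The reflection of the plane of curvature `κ` in the line with unit normal `n`. -/
def lineReflection {κ : ℝ} (n : Fin 3 → ℝ) (hn : normalForm κ n n = 1) :
    Equiv.Perm (Plane κ) where
  toFun x := ⟨reflectVec κ n x.1, reflectVec_mem hn x.2⟩
  invFun x := ⟨reflectVec κ n x.1, reflectVec_mem hn x.2⟩
  left_inv x := Subtype.ext (reflectVec_reflectVec hn x.1)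
  right_inv x := Subtype.ext (reflectVec_reflectVec hn x.1)

theorem lineReflection_sq {κ : ℝ} {n : Fin 3 → ℝ} (hn : normalForm κ n n = 1) :
    lineReflection n hn ^ 2 = 1 := by
  ext1 x
  rw [pow_two]
  exact Subtype.ext (reflectVec_reflectVec hn x.1)

theorem lineReflection_mul_sq {κ : ℝ} {n m : Fin 3 → ℝ} (hn : normalForm κ n n = 1)
    (hm : normalForm κ m m = 1) (h : normalForm κ n m = 0) :
    (lineReflection n hn * lineReflection m hm) ^ 2 = 1 := by
  have h1 : ∀ v, pairing n (reflectVec κ m v) = pairing n v := fun v => by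
    have : pairing n (reflectVec κ m v) = pairing n v - 2 * pairing m v * normalForm κ n m := by
      simp only [pairing, normalForm, reflectVec_zero, reflectVec_one, reflectVec_two]; ring
    rw [this, h]; ring
  have hcomm : ∀ v, reflectVec κ n (reflectVec κ m v) = reflectVec κ m (reflectVec κ n v) := by
    intro v
    have h2 : pairing m (reflectVec κ n v) = pairing m v := by
      have : pairing m (reflectVec κ n v) = pairing m v - 2 * pairing n v * normalForm κ n m := by
        simp only [pairing, normalForm, reflectVec_zero, reflectVec_one, reflectVec_two]; ring
      rw [this, h]; ring
    rw [reflectVec, h1, reflectVec, reflectVec, h2, reflectVec]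
    module
  ext1 x
  rw [pow_two]
  refine Subtype.ext ?_
  change reflectVec κ n (reflectVec κ m (reflectVec κ n (reflectVec κ m x.1))) = x.1
  rw [hcomm x.1, reflectVec_reflectVec hm, reflectVec_reflectVec hn]

/-- Two reflections in lines that enclose the angle `π / N` generate a dihedral group. -/
theorem lineReflection_mul_pow {κ : ℝ} {n m : Fin 3 → ℝ} (hn : normalForm κ n n = 1)
    (hm : normalForm κ m m = 1) {N : ℕ} (hN : 3 ≤ N)
    (h : normalForm κ n m = - Real.cos (Real.pi / N)) :
    (lineReflection n hn * lineReflection m hm) ^ N = 1 := by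
  have hN0 : (N : ℝ) ≠ 0 := by positivity
  let lin (n : Fin 3 → ℝ) : Module.Dual ℝ (Fin 3 → ℝ) :=
    { toFun := fun v => 2 * pairing n v
      map_add' := fun v w => by simp only [pairing, Pi.add_apply]; ring
      map_smul' := fun r v => by
        simp only [pairing, Pi.smul_apply, smul_eq_mul, RingHom.id_apply]; ring }
  let vec (n : Fin 3 → ℝ) : Fin 3 → ℝ := ![n 0, n 1, κ * n 2]
  have hlin : ∀ n m, lin n (vec m) = 2 * normalForm κ n m := fun n m => by
    simp [lin, vec, pairing, normalForm]; ring
  have hsymm : normalForm κ m n = normalForm κ n m := by simp only [normalForm]; ring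
  have hfn : lin n (vec n) = 2 := by rw [hlin, hn]; norm_num
  have hfm : lin m (vec m) = 2 := by rw [hlin, hm]; norm_num
  set θ : ℝ := 2 * (Real.pi / N) with hθ
  have ht : 2 * Real.cos θ = lin n (vec m) * lin m (vec n) - 2 := by
    rw [hlin, hlin, hsymm, h, hθ, Real.cos_two_mul]; ring
  have hsin : Real.sin θ ≠ 0 := by
    have h3 : (3 : ℝ) ≤ N := by exact_mod_cast hN
    refine (Real.sin_pos_of_pos_of_lt_pi (by positivity) ?_).ne'
    rw [hθ, ← mul_div_assoc, div_lt_iff₀ (by positivity)]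
    nlinarith [Real.pi_pos]
  have hS : ∀ j : ℤ, (Polynomial.Chebyshev.S ℝ j).eval (2 * Real.cos θ) =
      Real.sin ((j + 1) * θ) / Real.sin θ := fun j => by
    rw [eq_div_iff hsin, Polynomial.Chebyshev.S_two_mul_real_cos]
  have hlinpow : ∀ v, ((Module.reflection hfn * Module.reflection hfm) ^ N) v = v := by
    intro v
    rw [Module.reflection_mul_reflection_pow_apply hfn hfm N v _ ht]
    rcases Nat.even_or_odd' N with ⟨j, hj | hj⟩
    · have e1 : ((N : ℤ) - 2) / 2 = j - 1 := by omega
      have e2 : ((N : ℤ) - 1) / 2 = j - 1 := by omega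
      have hz : (Polynomial.Chebyshev.S ℝ ((j : ℤ) - 1)).eval (2 * Real.cos θ) = 0 := by
        rw [hS]
        have : (((j : ℤ) - 1 : ℤ) + 1 : ℝ) * θ = Real.pi := by
          have hj' : (N : ℝ) = 2 * j := by exact_mod_cast hj
          push_cast
          rw [hθ]
          field_simp
          rw [hj']; ring
        rw [this, Real.sin_pi, zero_div]
      rw [e1, e2, hz]; simp
    · have e1 : ((N : ℤ) - 1) / 2 = j := by omega
      have e2 : ((N : ℤ) - 3) / 2 = j - 1 := by omega
      have e3 : (N : ℤ) / 2 = j := by omega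
      have e4 : ((N : ℤ) - 2) / 2 = j - 1 := by omega
      have hz : (Polynomial.Chebyshev.S ℝ (j : ℤ)).eval (2 * Real.cos θ) +
          (Polynomial.Chebyshev.S ℝ ((j : ℤ) - 1)).eval (2 * Real.cos θ) = 0 := by
        rw [hS, hS]
        have hj' : (N : ℝ) = 2 * j + 1 := by exact_mod_cast hj
        have a1 : (((j : ℤ) : ℝ) + 1) * θ = Real.pi / N + Real.pi := by
          push_cast; rw [hθ]; field_simp; rw [hj']; ring
        have a2 : ((((j : ℤ) - 1 : ℤ) : ℝ) + 1) * θ = Real.pi - Real.pi / N := by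
          push_cast; rw [hθ]; field_simp; rw [hj']; ring
        rw [a1, a2, Real.sin_add_pi, Real.sin_pi_sub]; ring
      rw [e1, e2, e3, e4, hz]; simp
  have hone : ∀ (n : Fin 3 → ℝ) (hf : lin n (vec n) = 2) (v : Fin 3 → ℝ),
      Module.reflection hf v = reflectVec κ n v := fun n hf v => by
    rw [Module.reflection_apply]; rfl
  have htransfer : ∀ (j : ℕ) (x : Plane κ),
      (((lineReflection n hn * lineReflection m hm) ^ j) x).1 =
        ((Module.reflection hfn * Module.reflection hfm) ^ j) x.1 := by
    intro j
    induction j with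
    | zero => intro x; rfl
    | succ j ih =>
      intro x
      rw [pow_succ, pow_succ, Equiv.Perm.mul_apply, ih, LinearEquiv.mul_apply,
        LinearEquiv.mul_apply, hone, hone]
      rfl
  ext1 x
  refine Subtype.ext ?_
  rw [htransfer, hlinpow]
  rfl

/-! ### The orthogonal triangle with angles `π / 2`, `π / p`, `π / q` -/

section Triangle

variable (p q : ℕ)

/-- The curvature of the plane that is tiled: `1`, `0` or `-1` according as `1/p + 1/q` is greater
than, equal to or smaller than `1/2`. -/
def curvature : ℝ :=
  if (1 / 2 : ℝ) < 1 / p + 1 / q then 1 else if (1 / p + 1 / q : ℝ) = 1 / 2 then 0 else -1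

/-- The sphere, the Euclidean plane or the hyperbolic plane, whichever is tiled by `(p^q)`. -/
abbrev Space : Type := Plane (curvature p q)

/-- First coordinate of the unit normal of side `a`. -/
def normalAx : ℝ := - (Real.cos (Real.pi / q) / Real.sin (Real.pi / p))

/-- Third coordinate of the unit normal of side `a`. In the Euclidean plane, where it only fixes
the size of the triangle, it is `1`. -/
def normalAz : ℝ :=
  if curvature p q = 0 then 1 else Real.sqrt |1 - normalAx p q ^ 2|

/-- Inward unit normal of the side opposite to the angle `π / p`. -/
def normalA : Fin 3 → ℝ := ![normalAx p q, 0, normalAz p q]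

/-- Inward unit normal of the side opposite to the angle `π / 2`. -/
def normalB : Fin 3 → ℝ := ![Real.sin (Real.pi / p), - Real.cos (Real.pi / p), 0]

/-- Inward unit normal of the side opposite to the angle `π / q`. -/
def normalC : Fin 3 → ℝ := ![0, 1, 0]

/-- The closed triangle `F` with angles `π / 2`, `π / p`, `π / q`: by the lemmas `normalForm_ab`,
`normalForm_ac`, `normalForm_bc` below, the inward unit normals `n, m` of two sides that enclose the
angle `α` satisfy `normalForm n m = - cos α`. -/
def triangle : Set (Space p q) :=
  {x | 0 ≤ pairing (normalA p q) x.1 ∧ 0 ≤ pairing (normalB p) x.1 ∧ 0 ≤ pairing normalC x.1}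

theorem normalForm_bb : normalForm (curvature p q) (normalB p) (normalB p) = 1 := by
  have := Real.sin_sq_add_cos_sq (Real.pi / p)
  simp [normalForm, normalB]; nlinarith

theorem normalForm_cc : normalForm (curvature p q) normalC normalC = 1 := by
  simp [normalForm, normalC]

theorem normalForm_ac : normalForm (curvature p q) (normalA p q) normalC = 0 := by
  simp [normalForm, normalA, normalC]

theorem normalForm_bc :
    normalForm (curvature p q) (normalB p) normalC = - Real.cos (Real.pi / p) := by
  simp [normalForm, normalB, normalC]

theorem pi_div_bounds (n : ℕ) (hn : 3 ≤ n) : 0 < Real.pi / n ∧ Real.pi / n < Real.pi / 2 := by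
  have h3 : (3 : ℝ) ≤ n := by exact_mod_cast hn
  have hpi := Real.pi_pos
  exact ⟨by positivity, div_lt_div_of_pos_left hpi (by norm_num) (by linarith)⟩

theorem sin_pi_div_pos (n : ℕ) (hn : 3 ≤ n) : 0 < Real.sin (Real.pi / n) := by
  obtain ⟨h1, h2⟩ := pi_div_bounds n hn
  exact Real.sin_pos_of_pos_of_lt_pi h1 (by linarith [Real.pi_pos])

theorem normalForm_ab [hp : Fact (3 ≤ p)] :
    normalForm (curvature p q) (normalA p q) (normalB p) = - Real.cos (Real.pi / q) := by
  have h := (sin_pi_div_pos p hp.out).ne'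
  simp [normalForm, normalA, normalB, normalAx]
  field_simp

variable [hp : Fact (3 ≤ p)] [hq : Fact (3 ≤ q)]

theorem normalForm_aa : normalForm (curvature p q) (normalA p q) (normalA p q) = 1 := by
  obtain ⟨hp1, hp2⟩ := pi_div_bounds p hp.out
  obtain ⟨hq1, hq2⟩ := pi_div_bounds q hq.out
  have hs := sin_pi_div_pos p hp.out
  have hpi := Real.pi_pos
  have hc : Real.cos (Real.pi / q) = Real.sin (Real.pi / 2 - Real.pi / q) := by
    rw [Real.sin_pi_div_two_sub]
  have hc0 : 0 < Real.cos (Real.pi / q) := Real.cos_pos_of_mem_Ioo ⟨by linarith, hq2⟩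
  have hangle : Real.pi / p - (Real.pi / 2 - Real.pi / q) =
      Real.pi * ((1 / p + 1 / q : ℝ) - 1 / 2) := by ring
  have key : normalAx p q ^ 2 + curvature p q * normalAz p q ^ 2 = 1 := by
    have hx : normalAx p q ^ 2 = (Real.cos (Real.pi / q) / Real.sin (Real.pi / p)) ^ 2 := by
      rw [normalAx, neg_sq]
    rcases lt_trichotomy (1 / 2 : ℝ) (1 / p + 1 / q) with hlt | heq | hgt
    · have hκ : curvature p q = 1 := if_pos hlt
      have hlt' : Real.cos (Real.pi / q) < Real.sin (Real.pi / p) := by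
        rw [hc]
        refine Real.sin_lt_sin_of_lt_of_le_pi_div_two (by linarith) hp2.le ?_
        nlinarith [mul_pos hpi (sub_pos.2 hlt)]
      have h1 : normalAx p q ^ 2 < 1 := by
        rw [hx]
        exact pow_lt_one₀ (by positivity) ((div_lt_one hs).2 hlt') two_ne_zero
      rw [hκ, normalAz, hκ, if_neg one_ne_zero, Real.sq_sqrt (abs_nonneg _),
        abs_of_pos (by linarith)]
      ring
    · have hκ : curvature p q = 0 := by
        rw [curvature, if_neg (by rw [← heq]; exact lt_irrefl _), if_pos heq.symm]
      have he : Real.cos (Real.pi / q) = Real.sin (Real.pi / p) := by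
        rw [hc]; congr 1
        rw [← heq] at hangle; linarith
      rw [hκ, hx, he, div_self hs.ne']; ring
    · have hκ : curvature p q = -1 := by
        rw [curvature, if_neg hgt.not_gt, if_neg hgt.ne]
      have hlt' : Real.sin (Real.pi / p) < Real.cos (Real.pi / q) := by
        rw [hc]
        refine Real.sin_lt_sin_of_lt_of_le_pi_div_two (by linarith) (by linarith) ?_
        nlinarith [mul_pos hpi (sub_pos.2 hgt)]
      have h1 : 1 < normalAx p q ^ 2 := by
        rw [hx]
        exact one_lt_pow₀ ((one_lt_div hs).2 hlt') two_ne_zero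
      rw [hκ, normalAz, hκ, if_neg (by norm_num), Real.sq_sqrt (abs_nonneg _),
        abs_of_neg (by linarith)]
      ring
  rw [← key]
  simp [normalForm, normalA]; ring

theorem normalA_sq : normalAx p q ^ 2 + curvature p q * normalAz p q ^ 2 = 1 := by
  rw [← normalForm_aa p q]
  simp [normalForm, normalA]; ring

theorem normalAx_neg : normalAx p q < 0 := by
  obtain ⟨hq1, hq2⟩ := pi_div_bounds q hq.out
  have hc0 : 0 < Real.cos (Real.pi / q) :=
    Real.cos_pos_of_mem_Ioo ⟨by linarith [Real.pi_pos], hq2⟩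
  exact neg_lt_zero.2 (div_pos hc0 (sin_pi_div_pos p hp.out))

/-- The vertex of the triangle with angle `π / p`; it is the centre of a face of `(p^q)`. -/
def faceCentre : Space p q := ⟨![0, 0, 1], by simp⟩

/-- The vertex of the triangle with the right angle; it is the midpoint of an edge of `(p^q)`. -/
def edgeMidpoint : Space p q := ⟨![normalAz p q, 0, - normalAx p q], by
  have h := normalA_sq p q
  refine ⟨?_, fun _ => ?_⟩
  · simpa using h
  · simpa using normalAx_neg p q⟩

/-- The vertex of the triangle with angle `π / q`; it is a vertex of `(p^q)`. -/
def vertexPoint : Space p q :=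
  ⟨(Real.sin (Real.pi / q))⁻¹ • ![normalAz p q * Real.cos (Real.pi / p),
    normalAz p q * Real.sin (Real.pi / p), - normalAx p q * Real.cos (Real.pi / p)], by
  have h := normalA_sq p q
  have hs := sin_pi_div_pos p hp.out
  have hs' := sin_pi_div_pos q hq.out
  obtain ⟨hp1, hp2⟩ := pi_div_bounds p hp.out
  have hc : 0 < Real.cos (Real.pi / p) :=
    Real.cos_pos_of_mem_Ioo ⟨by linarith [Real.pi_pos], hp2⟩
  have e1 := Real.sin_sq_add_cos_sq (Real.pi / p)
  have e2 := Real.sin_sq_add_cos_sq (Real.pi / q)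
  have e3 : normalAx p q * Real.sin (Real.pi / p) = - Real.cos (Real.pi / q) := by
    rw [normalAx]; field_simp
  refine ⟨?_, fun _ => ?_⟩
  · simp
    field_simp
    have e4 : normalAx p q ^ 2 * Real.sin (Real.pi / p) ^ 2 = Real.cos (Real.pi / q) ^ 2 := by
      rw [← mul_pow, e3, neg_sq]
    linear_combination h + (normalAx p q ^ 2 + curvature p q * normalAz p q ^ 2) * e1 - e4 - e2
  · simpa using mul_neg_of_pos_of_neg (inv_pos.2 hs')
      (mul_neg_of_neg_of_pos (normalAx_neg p q) hc)⟩

end Triangle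

/-! ### The Coxeter group `G_{p,q}` and its action -/

/-- The names of the three generators. -/
inductive Gen
  | a
  | b
  | c

/-- The relators `a², b², c², (ab)^q, (ac)², (bc)^p`. -/
def relators (p q : ℕ) : Set (FreeGroup Gen) :=
  let a := FreeGroup.of Gen.a
  let b := FreeGroup.of Gen.b
  let c := FreeGroup.of Gen.c
  {a ^ 2, b ^ 2, c ^ 2, (a * b) ^ q, (a * c) ^ 2, (b * c) ^ p}

/-- `G_{p,q} = ⟨a, b, c | a² = b² = c² = (ab)^q = (ac)² = (bc)^p = 1⟩`. -/
abbrev CoxeterG (p q : ℕ) : Type := PresentedGroup (relators p q)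

/-- The generators of `G_{p,q}`. -/
def genA (p q : ℕ) : CoxeterG p q := PresentedGroup.of Gen.a
def genB (p q : ℕ) : CoxeterG p q := PresentedGroup.of Gen.b
def genC (p q : ℕ) : CoxeterG p q := PresentedGroup.of Gen.c

section Action

variable (p q : ℕ) [hp : Fact (3 ≤ p)] [hq : Fact (3 ≤ q)]

/-- The reflections in the three sides of the triangle. -/
def sideReflection : Gen → Equiv.Perm (Space p q)
  | .a => lineReflection (normalA p q) (normalForm_aa p q)
  | .b => lineReflection (normalB p) (normalForm_bb p q)
  | .c => lineReflection normalC (normalForm_cc p q)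

theorem sideReflection_relators :
    ∀ r ∈ relators p q, FreeGroup.lift (sideReflection p q) r = 1 := by
  intro r hr
  simp only [relators, Set.mem_insert_iff, Set.mem_singleton_iff] at hr
  rcases hr with rfl | rfl | rfl | rfl | rfl | rfl <;>
    simp only [map_pow, map_mul, FreeGroup.lift_apply_of]
  · exact lineReflection_sq (normalForm_aa p q)
  · exact lineReflection_sq (normalForm_bb p q)
  · exact lineReflection_sq (normalForm_cc p q)
  · exact lineReflection_mul_pow (normalForm_aa p q) (normalForm_bb p q) hq.out
      (normalForm_ab p q)
  · exact lineReflection_mul_sq (normalForm_aa p q) (normalForm_cc p q) (normalForm_ac p q)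
  · exact lineReflection_mul_pow (normalForm_bb p q) (normalForm_cc p q) hp.out
      (normalForm_bc p q)

/-- `G_{p,q}` acts on the plane: `a`, `b`, `c` act as the reflections in the sides of the triangle
opposite to the angles `π / p`, `π / 2`, `π / q`, respectively. -/
def toPerm : CoxeterG p q →* Equiv.Perm (Space p q) :=
  PresentedGroup.toGroup (sideReflection_relators p q)

instance : MulAction (CoxeterG p q) (Space p q) := MulAction.compHom _ (toPerm p q)

/-- `G_{p,q}` as a group of transformations of the plane. -/
def transformationGroup : Subgroup (Equiv.Perm (Space p q)) := (toPerm p q).range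

/-! ### The tilings -/

/-- The tiling `T_{p,q}` by the triangles `gF`. -/
def triangleTiling : Set (Set (Space p q)) := Set.range fun g : CoxeterG p q => g • triangle p q

variable {p q} in
/-- The union of the triangles `dF` with `d ∈ D`. -/
def patch (D : Subgroup (CoxeterG p q)) : Set (Space p q) := ⋃ d ∈ D, d • triangle p q

variable {p q} in
/-- The collection of all images under `G_{p,q}` of the union of the triangles `dF`, `d ∈ D`. -/
def orbitTiling (D : Subgroup (CoxeterG p q)) : Set (Set (Space p q)) :=
  Set.range fun g : CoxeterG p q => g • patch D

/-- The regular tiling `(p^q)`. A tile is the regular `p`-gon formed by the `2p` triangles around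
the vertex of `F` with angle `π / p`. -/
def tilingPQ : Set (Set (Space p q)) := orbitTiling (Subgroup.closure {genB p q, genC p q})

/-- The regular tiling `(q^p)`, dual to `(p^q)`. A tile is the regular `q`-gon formed by the `2q`
triangles around the vertex of `F` with angle `π / q`. -/
def tilingQP : Set (Set (Space p q)) := orbitTiling (Subgroup.closure {genA p q, genB p q})

/-- The Laves tiling `[p.q.p.q]`, whose edges are the segments that join the centres of the `p`-gons
of `(p^q)` to their vertices, that is, the images of the hypotenuse of `F`. A tile is the
quadrilateral formed by the four triangles around the right angle of `F`. -/
def tilingLaves : Set (Set (Space p q)) := orbitTiling (Subgroup.closure {genA p q, genC p q})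

end Action

/-! ### Symmetries, colourings, perfect colourings -/

/-- The symmetry group of a tiling: all isometries of the plane that map the tiling to itself. -/
def symmetryGroup {κ : ℝ} (𝒯 : Set (Set (Plane κ))) : Subgroup (Equiv.Perm (Plane κ)) :=
  isometryGroup κ ⊓ MulAction.stabilizer (Equiv.Perm (Plane κ)) 𝒯

/-- The pair `(f, π)` is a colour symmetry of the colouring `c`: the tile `f P` has colour
`π (c P)`. -/
def IsColourSymmetry {κ : ℝ} {𝒯 : Set (Set (Plane κ))} {k : ℕ} (c : 𝒯 → Fin k)
    (f : Equiv.Perm (Plane κ)) (π : Equiv.Perm (Fin k)) : Prop :=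
  ∀ P Q : 𝒯, (Q : Set (Plane κ)) = f • (P : Set (Plane κ)) → c Q = π (c P)

/-- `c` is a `k`-colouring (all `k` colours occur) that is perfect with respect to the group `H` of
symmetries: every element of `H` permutes the colours. -/
def IsPerfectColouring {κ : ℝ} {𝒯 : Set (Set (Plane κ))} {k : ℕ}
    (H : Subgroup (Equiv.Perm (Plane κ))) (c : 𝒯 → Fin k) : Prop :=
  Function.Surjective c ∧ ∀ f ∈ H, ∃ π : Equiv.Perm (Fin k), IsColourSymmetry c f π

section Induced

variable {p q k : ℕ} [Fact (3 ≤ p)] [Fact (3 ≤ q)]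

/-- `c` is a left coset colouring of `T_{p,q}`: for some numbering of the left cosets of `S` by the
`k` colours, the triangle `gF` has the number of `gS` as its colour. -/
def IsLeftCosetColouring (S : Subgroup (CoxeterG p q)) (c : triangleTiling p q → Fin k) : Prop :=
  ∃ e : CoxeterG p q ⧸ S ≃ Fin k, ∀ g : CoxeterG p q,
    c ⟨g • triangle p q, g, rfl⟩ = e (QuotientGroup.mk g)

/-- The subgroup `S` induces the colouring `d` of the tiling `𝒯`: in a left coset colouring of
`T_{p,q}`, all triangles that form a tile have the same colour, and this is its colour under `d`. -/
def Induces (S : Subgroup (CoxeterG p q)) {𝒯 : Set (Set (Space p q))} (d : 𝒯 → Fin k) : Prop :=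
  ∃ c : triangleTiling p q → Fin k, IsLeftCosetColouring S c ∧
    ∀ (P : 𝒯) (t : triangleTiling p q), (t : Set (Space p q)) ⊆ P → c t = d P

/-- `S` induces a `k`-colouring of `𝒯` that is perfect with respect to `H`. -/
def InducesPerfect (k : ℕ) (H : Subgroup (Equiv.Perm (Space p q))) (S : Subgroup (CoxeterG p q))
    (𝒯 : Set (Set (Space p q))) : Prop :=
  ∃ d : 𝒯 → Fin k, IsPerfectColouring H d ∧ Induces S d

end Induced

end PerfectColouring

end

open PerfectColouring

/-!
Under the reflections `a`, `b`, `c` the heights of a point over the three sides of `F` behave like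
the simple roots of the Coxeter group. Tits' induction on the length, whose dihedral step compares
Chebyshev polynomials at `cos (π / m)`, shows that an element without left descent at the side `s`
pulls the height over `s` back to a nonnegative combination of heights. Hence distinct triangles
`gF` and `hF` have disjoint interiors, and the stabiliser of a vertex of `F` is generated by the two
reflections that fix it.

The centre of a tile is the barycentre of the orbit of its farthest vertices under the stabiliser of
the centre. So an isometry that preserves the tile fixes the centre and permutes the farthest
vertices; up to an element of the group it fixes two vertices of `F`, and then it is the identity
or a reflection. A tile of the Laves tiling has a single orbit of farthest vertices because the legs
of `F` have different lengths if `p ≠ q`.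

A perfect colouring is determined by the stabiliser of the colour of the tile that contains `F`: the
colours correspond to its left cosets.
-/

namespace PerfectColouring

/-! ### Nonnegativity of root coefficients -/

section Tits

open Polynomial CoxeterSystem
open scoped NNReal

theorem chebyshevU_cos_pi_div_nonneg {m n : ℕ} (h : m ≠ 0 → n < m) :
    0 ≤ (Chebyshev.U ℝ n).eval (Real.cos (Real.pi / m)) := by
  rcases Nat.eq_zero_or_pos m with rfl | hm
  · simp only [Nat.cast_zero, div_zero, Real.cos_zero, Chebyshev.U_eval_one]
    positivity
  rcases Nat.eq_zero_or_pos n with rfl | hn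
  · simp
  have hm0 : (0 : ℝ) < m := by positivity
  have hnm : (n : ℝ) + 1 ≤ m := by exact_mod_cast h hm.ne'
  have hm2 : (1 : ℝ) < m := by exact_mod_cast lt_of_le_of_lt hn (h hm.ne')
  have hsin : 0 < Real.sin (Real.pi / m) :=
    Real.sin_pos_of_pos_of_lt_pi (by positivity) (div_lt_self Real.pi_pos hm2)
  refine nonneg_of_mul_nonneg_left ?_ hsin
  rw [Chebyshev.U_real_cos]
  refine Real.sin_nonneg_of_nonneg_of_le_pi (by positivity) ?_
  calc ((n : ℤ) + 1 : ℝ) * (Real.pi / m) ≤ m * (Real.pi / m) := by push_cast; gcongr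
    _ = Real.pi := mul_div_cancel₀ _ hm0.ne'

variable {B W X : Type*} [Group W] {M : CoxeterMatrix B} (cs : CoxeterSystem M W)

theorem exists_alternatingWord_mul {g : W} {s : B} (hs : ¬cs.IsLeftDescent g s) (t : B) :
    ∃ (k : ℕ) (j j' : B) (v : W), (if Even k then j' else j) = s ∧ (if Even k then j else j') = t ∧
      cs.wordProd (alternatingWord j j' k) * v = g ∧ k + cs.length v = cs.length g ∧
      ¬cs.IsLeftDescent v j ∧ ¬cs.IsLeftDescent v j' := by
  induction hl : cs.length g using Nat.strong_induction_on generalizing g s t with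
  | _ l ih =>
    by_cases ht : cs.IsLeftDescent g t
    · have hlen : cs.length (cs.simple t * g) + 1 = cs.length g := cs.isLeftDescent_iff.1 ht
      obtain ⟨k, j, j', v, hs', ht', hg, hlv, hj, hj'⟩ :=
        ih _ (by omega) (cs.isLeftDescent_iff_not_isLeftDescent_mul.1 ht) s rfl
      refine ⟨k + 1, j, j', v, ?_, ?_, ?_, by omega, hj, hj'⟩
      · simpa only [Nat.even_add_one, ite_not] using ht'
      · simpa only [Nat.even_add_one, ite_not] using hs'
      · rw [alternatingWord_succ', hs', cs.wordProd_cons, mul_assoc, hg,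
          cs.simple_mul_simple_cancel_left]
    · exact ⟨0, t, s, g, rfl, rfl, one_mul g, by simpa using hl, ht, hs⟩

theorem lt_of_alternatingWord_mul {j j' : B} {k : ℕ} {v : W}
    (hs : ¬cs.IsLeftDescent (cs.wordProd (alternatingWord j j' k) * v) (if Even k then j' else j))
    (hl : k + cs.length v = cs.length (cs.wordProd (alternatingWord j j' k) * v))
    (hM : M j j' ≠ 0) : k < M j j' := by
  by_contra! hk
  refine cs.not_isReduced_alternatingWord j j' hM (m := k + 1) (by omega) ?_
  have hsl := cs.not_isLeftDescent_iff.1 hs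
  rw [← mul_assoc, ← cs.wordProd_cons, ← alternatingWord_succ'] at hsl
  have h₁ := cs.length_mul_le (cs.wordProd (alternatingWord j j' (k + 1))) v
  have h₂ := cs.length_wordProd_le (alternatingWord j j' (k + 1))
  rw [CoxeterSystem.IsReduced]
  rw [length_alternatingWord] at h₂ ⊢
  omega

variable [MulAction W X]

/-- The functions `h s` on `X` behave under the simple reflections like the simple roots of the
geometric representation: `h s` is the height above the wall of the fundamental chamber that is
fixed by `s`. As in Mathlib's Coxeter matrices, `M s t = 0` stands for `∞`; the formula is then
the usual one, since `cos (π / 0) = 1`. -/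
def IsReflectionHeight (h : B → X → ℝ) : Prop :=
  ∀ s t x, h s (cs.simple t • x) = h s x + 2 * Real.cos (Real.pi / M s t) * h t x

namespace IsReflectionHeight

variable {cs} {h : B → X → ℝ} (hh : IsReflectionHeight cs h)
include hh

theorem simple_smul (s : B) (x : X) : h s (cs.simple s • x) = -h s x := by
  rw [hh, M.diagonal, Nat.cast_one, div_one, Real.cos_pi]
  ring

theorem alternatingWord_smul (j j' : B) (k : ℕ) (x : X) :
    h (if Even k then j' else j) (cs.wordProd (alternatingWord j j' k) • x) =
      (Chebyshev.U ℝ k).eval (Real.cos (Real.pi / M j j')) * h j' x +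
        (Chebyshev.U ℝ (k - 1)).eval (Real.cos (Real.pi / M j j')) * h j x := by
  induction k generalizing j j' x with
  | zero => simp [alternatingWord]
  | succ k ih =>
    have hif : (if Even (k + 1) then j' else j) = if Even k then j else j' := by
      simp only [Nat.even_add_one, ite_not]
    rw [hif, alternatingWord_succ, cs.wordProd_concat, mul_smul, ih, hh.simple_smul, hh j j',
      M.symmetric j' j, Nat.cast_add_one, Chebyshev.U_add_one]
    simp only [add_sub_cancel_right, eval_sub, eval_mul, eval_ofNat, eval_X]
    ring

/-- Every element of `W` maps a simple root to a positive or to a negative root. -/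
theorem comp_smul_mem_span {g : W} {s : B} (hs : ¬cs.IsLeftDescent g s) :
    (fun x => h s (g • x)) ∈ Submodule.span ℝ≥0 (Set.range h) := by
  induction hl : cs.length g using Nat.strong_induction_on generalizing g s with
  | _ l ih =>
    by_cases hg : g = 1
    · simpa [hg] using Submodule.subset_span (Set.mem_range_self s)
    obtain ⟨t, ht⟩ := cs.exists_leftDescent_of_ne_one hg
    obtain ⟨k, j, j', v, rfl, rfl, rfl, hlv, hj, hj'⟩ := exists_alternatingWord_mul cs hs t
    have hk : k ≠ 0 := by
      rintro rfl
      exact hj (by simpa [alternatingWord] using ht)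
    obtain ⟨n, rfl⟩ := Nat.exists_eq_add_one_of_ne_zero hk
    have hlt := lt_of_alternatingWord_mul cs hs hlv
    have key : (fun x => h (if Even (n + 1) then j' else j)
        ((cs.wordProd (alternatingWord j j' (n + 1)) * v) • x)) =
        (⟨_, chebyshevU_cos_pi_div_nonneg hlt⟩ : ℝ≥0) • (fun x => h j' (v • x)) +
        (⟨_, chebyshevU_cos_pi_div_nonneg fun h0 => (Nat.lt_succ_self n).trans (hlt h0)⟩ : ℝ≥0) •
          (fun x => h j (v • x)) := by
      funext x
      rw [mul_smul, hh.alternatingWord_smul,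
        show ((n + 1 : ℕ) : ℤ) - 1 = n by rw [Nat.cast_add_one, add_sub_cancel_right]]
      rfl
    rw [key]
    exact add_mem (Submodule.smul_mem _ _ (ih _ (by omega) hj' rfl))
      (Submodule.smul_mem _ _ (ih _ (by omega) hj rfl))

theorem nonneg_of_not_isLeftDescent {g : W} {s : B} (hs : ¬cs.IsLeftDescent g s) {x : X}
    (hx : ∀ t, 0 ≤ h t x) : 0 ≤ h s (g • x) := by
  refine Submodule.span_induction (p := fun f _ => 0 ≤ f x) ?_ le_rfl
    (fun _ _ _ _ => add_nonneg) (fun c _ _ hf => mul_nonneg c.2 hf) (hh.comp_smul_mem_span hs)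
  rintro _ ⟨t, rfl⟩
  exact hx t

theorem pos_of_not_isLeftDescent {g : W} {s : B} (hs : ¬cs.IsLeftDescent g s) {x : X}
    (hx : ∀ t, 0 < h t x) : 0 < h s (g • x) := by
  have hzero_or_pos : (fun y => h s (g • y)) = 0 ∨ 0 < h s (g • x) := by
    refine Submodule.span_induction (p := fun f _ => f = 0 ∨ 0 < f x) ?_ (Or.inl rfl) ?_ ?_
      (hh.comp_smul_mem_span hs)
    · rintro _ ⟨t, rfl⟩
      exact Or.inr (hx t)
    · rintro f₁ f₂ - - (rfl | h₁) (rfl | h₂)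
      · simp
      · simpa using Or.inr h₂
      · simpa using Or.inr h₁
      · exact Or.inr (add_pos h₁ h₂)
    · rintro c f - (rfl | hf)
      · simp
      · rcases eq_zero_or_pos c with rfl | hc
        · simp
        · exact Or.inr (mul_pos hc hf)
  refine hzero_or_pos.resolve_left fun hzero => (hx s).ne' ?_
  simpa using congrFun hzero (g⁻¹ • x)

theorem eq_one_of_smul_mem_chamber {g : W} {x : X} (hx : ∀ s, 0 < h s x)
    (hgx : ∀ s, 0 ≤ h s (g • x)) : g = 1 := by
  by_contra hg
  obtain ⟨s, hs⟩ := cs.exists_leftDescent_of_ne_one hg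
  have hpos := hh.pos_of_not_isLeftDescent (cs.isLeftDescent_iff_not_isLeftDescent_mul.1 hs) hx
  rw [mul_smul, hh.simple_smul] at hpos
  linarith [hgx s]

theorem stabilizer_eq_closure (hfix : ∀ s x, h s x = 0 → cs.simple s • x = x) {x : X}
    (hx : ∀ s, 0 ≤ h s x) :
    MulAction.stabilizer W x = Subgroup.closure (cs.simple '' {s | h s x = 0}) := by
  refine le_antisymm (fun g hg => ?_) ?_
  · induction hl : cs.length g using Nat.strong_induction_on generalizing g with
    | _ l ih =>
      by_cases hg1 : g = 1
      · exact hg1 ▸ one_mem _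
      obtain ⟨s, hs⟩ := cs.exists_leftDescent_of_ne_one hg1
      have hsx : h s x = 0 := by
        have hneg := hh.nonneg_of_not_isLeftDescent
          (cs.isLeftDescent_iff_not_isLeftDescent_mul.1 hs) hx
        rw [mul_smul, hh.simple_smul, MulAction.mem_stabilizer_iff.1 hg] at hneg
        linarith [hx s]
      have hmem : cs.simple s * g ∈ Subgroup.closure (cs.simple '' {s | h s x = 0}) := by
        refine ih _ (hl ▸ hs) _ ?_ rfl
        rw [MulAction.mem_stabilizer_iff, mul_smul, MulAction.mem_stabilizer_iff.1 hg,
          hfix s x hsx]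
      rw [← cs.simple_mul_simple_cancel_left s (w := g)]
      exact mul_mem (Subgroup.subset_closure ⟨s, hsx, rfl⟩) hmem
  · rw [Subgroup.closure_le]
    rintro _ ⟨s, hs, rfl⟩
    exact hfix s x hs

end IsReflectionHeight

end Tits

section Coxeter

variable (p q : ℕ)

/-- The inward unit normals of the sides of the triangle, indexed by the reflections in them. -/
noncomputable def normal : Gen → Fin 3 → ℝ
  | .a => normalA p q
  | .b => normalB p
  | .c => normalC

theorem normalForm_comm (κ : ℝ) (n m : Fin 3 → ℝ) : normalForm κ n m = normalForm κ m n := by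
  simp only [normalForm]; ring

theorem pairing_reflectVec_eq (κ : ℝ) (n m v : Fin 3 → ℝ) :
    pairing n (reflectVec κ m v) = pairing n v - 2 * pairing m v * normalForm κ n m := by
  simp only [pairing, normalForm, reflectVec_zero, reflectVec_one, reflectVec_two]; ring

variable {p q} in
/-- The height of a point above a side of the triangle, up to a monotone reparametrisation: the
triangle consists of the points at which all three heights are nonnegative. -/
noncomputable def height (s : Gen) (x : Space p q) : ℝ := pairing (normal p q s) x.1

variable {p q} in
theorem mem_triangle_iff {x : Space p q} : x ∈ triangle p q ↔ ∀ s, 0 ≤ height s x :=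
  ⟨fun h s => by
    cases s
    exacts [h.1, h.2.1, h.2.2],
    fun h => ⟨h .a, h .b, h .c⟩⟩

variable [Fact (3 ≤ p)] [Fact (3 ≤ q)]

/-- The Coxeter matrix of the triangle group `G_{p,q}`. -/
def coxeterMatrix : CoxeterMatrix Gen where
  M
    | .a, .a | .b, .b | .c, .c => 1
    | .a, .b | .b, .a => q
    | .a, .c | .c, .a => 2
    | .b, .c | .c, .b => p
  isSymm := by ext (_ | _ | _) (_ | _ | _) <;> rfl
  diagonal := by rintro (_ | _ | _) <;> rfl
  off_diagonal := by
    have hp : 3 ≤ p := Fact.out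
    have hq : 3 ≤ q := Fact.out
    rintro (_ | _ | _) (_ | _ | _) h <;> first | exact absurd rfl h | grind

theorem normalClosure_relationsSet :
    Subgroup.normalClosure (coxeterMatrix p q).relationsSet =
      Subgroup.normalClosure (relators p q) := by
  refine le_antisymm (Subgroup.normalClosure_le_normal ?_) (Subgroup.normalClosure_mono ?_)
  · have mem : relators p q ⊆ Subgroup.normalClosure (relators p q) :=
      Subgroup.subset_normalClosure
    have swap (s t : FreeGroup Gen) (n : ℕ) (h : (s * t) ^ n ∈ relators p q) :
        (t * s) ^ n ∈ Subgroup.normalClosure (relators p q) := by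
      rw [show t * s = t * (s * t) * t⁻¹ by group, conj_pow]
      exact Subgroup.normalClosure_normal.conj_mem _ (mem h) t
    rintro _ ⟨⟨_ | _ | _, _ | _ | _⟩, rfl⟩
    all_goals first
      | refine mem ?_
        simp [Function.uncurry, CoxeterMatrix.relation, coxeterMatrix, relators, pow_two]
        done
      | exact swap _ _ _ (by simp [coxeterMatrix, relators])
  · rintro _ (rfl | rfl | rfl | rfl | rfl | rfl)
    · exact ⟨(.a, .a), (pow_one _).trans (pow_two _).symm⟩
    · exact ⟨(.b, .b), (pow_one _).trans (pow_two _).symm⟩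
    · exact ⟨(.c, .c), (pow_one _).trans (pow_two _).symm⟩
    · exact ⟨(.a, .b), rfl⟩
    · exact ⟨(.a, .c), rfl⟩
    · exact ⟨(.b, .c), rfl⟩

/-- The presentation of `G_{p,q}` as a Coxeter system, which makes Mathlib's length function and
descents available. -/
def coxeterSystem : CoxeterSystem (coxeterMatrix p q) (CoxeterG p q) where
  mulEquiv := QuotientGroup.quotientMulEquivOfEq (normalClosure_relationsSet p q).symm

/-- The generator of `G_{p,q}` with the given name, so that `gen p q .a` is `genA p q`. -/
def gen (s : Gen) : CoxeterG p q := PresentedGroup.of s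

theorem coxeterSystem_simple (s : Gen) : (coxeterSystem p q).simple s = gen p q s := rfl

theorem normalForm_normal (s t : Gen) :
    normalForm (curvature p q) (normal p q s) (normal p q t) =
      -Real.cos (Real.pi / coxeterMatrix p q s t) := by
  rcases s with _ | _ | _ <;> rcases t with _ | _ | _ <;>
    simp [normal, coxeterMatrix, normalForm_aa, normalForm_bb, normalForm_cc, normalForm_ab,
      normalForm_ac, normalForm_bc, normalForm_comm _ (normalB p) (normalA p q),
      normalForm_comm _ normalC]

theorem normalForm_normal_self (s : Gen) :
    normalForm (curvature p q) (normal p q s) (normal p q s) = 1 := by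
  rw [normalForm_normal, (coxeterMatrix p q).diagonal, Nat.cast_one, div_one, Real.cos_pi, neg_neg]

variable {p q}

theorem coe_gen_smul (s : Gen) (x : Space p q) :
    (gen p q s • x).1 = reflectVec (curvature p q) (normal p q s) x.1 := by
  change (toPerm p q (PresentedGroup.of s) x).1 = _
  rw [toPerm, PresentedGroup.toGroup.of]
  cases s <;> rfl

theorem isReflectionHeight_height :
    IsReflectionHeight (coxeterSystem p q) (height : Gen → Space p q → ℝ) := fun s t x => by
  rw [coxeterSystem_simple, height, coe_gen_smul, pairing_reflectVec_eq, normalForm_normal,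
    height, height]
  ring

theorem gen_smul_eq_self {s : Gen} {x : Space p q} (h : height s x = 0) : gen p q s • x = x := by
  rw [height] at h
  refine Subtype.ext ?_
  rw [coe_gen_smul, reflectVec, h, mul_zero, zero_smul, sub_zero]

end Coxeter

/-! ### Plane geometry in the quadratic form model -/

section PlaneGeometry

/-- The square of the length of the chord from `x` to `y`, measured in the quadratic form that
induces the metric of the plane of curvature `κ`. It is a function of the distance, and the
plane geometry below is done with it in a way that does not depend on `κ`. -/
def sqDist (κ : ℝ) (x y : Fin 3 → ℝ) : ℝ := normalForm κ (x - y) (x - y)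

/-- The bilinear form for which the plane of curvature `κ` is (part of) the unit sphere; its value
at two points is the cosine of their distance if `κ = 1`, the hyperbolic cosine if `κ = -1`. -/
def pointForm (κ : ℝ) (x y : Fin 3 → ℝ) : ℝ := x 2 * y 2 + κ * (x 0 * y 0 + x 1 * y 1)

/-- The linear form that vanishes at the points of the plane with equal distances to `y` and `z`. -/
def bisector (κ : ℝ) (y z : Fin 3 → ℝ) : Fin 3 → ℝ :=
  ![2 * (y 0 - z 0), 2 * (y 1 - z 1),
    2 * κ * (y 2 - z 2) - (normalForm κ y y - normalForm κ z z)]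

theorem pairing_eq_dotProduct (n v : Fin 3 → ℝ) : pairing n v = n ⬝ᵥ v := by
  simp only [pairing, dotProduct, Fin.sum_univ_three]

theorem pairing_add (n v w : Fin 3 → ℝ) : pairing n (v + w) = pairing n v + pairing n w := by
  simp only [pairing_eq_dotProduct, dotProduct_add]

theorem pairing_smul (n : Fin 3 → ℝ) (r : ℝ) (v : Fin 3 → ℝ) :
    pairing n (r • v) = r * pairing n v := by
  simp only [pairing_eq_dotProduct, dotProduct_smul, smul_eq_mul]

theorem pairing_sum {ι : Type*} (n : Fin 3 → ℝ) (I : Finset ι) (v : ι → Fin 3 → ℝ) :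
    pairing n (∑ i ∈ I, v i) = ∑ i ∈ I, pairing n (v i) := by
  simp only [pairing_eq_dotProduct, dotProduct_sum]

theorem pointForm_comm (κ : ℝ) (v w : Fin 3 → ℝ) : pointForm κ v w = pointForm κ w v := by
  simp only [pointForm]; ring

theorem pointForm_eq_pairing (κ : ℝ) (v w : Fin 3 → ℝ) :
    pointForm κ v w = pairing ![κ * v 0, κ * v 1, v 2] w := by
  simp only [pointForm, pairing, Matrix.cons_val]; ring

theorem pointForm_smul_right (κ r : ℝ) (v w : Fin 3 → ℝ) :
    pointForm κ v (r • w) = r * pointForm κ v w := by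
  simp only [pointForm_eq_pairing, pairing_smul]

theorem pointForm_sum_right {ι : Type*} (κ : ℝ) (v : Fin 3 → ℝ) (I : Finset ι)
    (w : ι → Fin 3 → ℝ) : pointForm κ v (∑ i ∈ I, w i) = ∑ i ∈ I, pointForm κ v (w i) := by
  simp only [pointForm_eq_pairing, pairing_sum]

variable {κ : ℝ}

theorem pointForm_self (x : Plane κ) : pointForm κ x.1 x.1 = 1 := by
  rw [pointForm]
  linear_combination x.2.1

theorem two_eq_one_of_euclidean (x : Plane 0) : x.1 2 = 1 := by
  nlinarith [x.2.1, x.2.2 le_rfl]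

theorem sqDist_self (x : Fin 3 → ℝ) : sqDist κ x x = 0 := by
  simp [sqDist, normalForm]

theorem sqDist_comm (x y : Fin 3 → ℝ) : sqDist κ x y = sqDist κ y x := by
  simp only [sqDist, normalForm, Pi.sub_apply]; ring

variable (hκ : κ = 1 ∨ κ = 0 ∨ κ = -1)
include hκ

/-- Either `κ ^ 2 = 1`, or `κ = 0` and the plane is `{v | v 2 = 1}`. -/
theorem curvature_sq_mul_sub (x y : Plane κ) : κ ^ 2 * (x.1 2 - y.1 2) = x.1 2 - y.1 2 := by
  rcases hκ with rfl | rfl | rfl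
  · ring
  · rw [two_eq_one_of_euclidean x, two_eq_one_of_euclidean y]; ring
  · ring

theorem curvature_mul_sqDist (x y : Plane κ) :
    κ * sqDist κ x.1 y.1 = 2 * (1 - pointForm κ x.1 y.1) := by
  simp only [sqDist, normalForm, pointForm, Pi.sub_apply]
  linear_combination (x.1 2 - y.1 2) * curvature_sq_mul_sub hκ x y + x.2.1 + y.2.1

theorem exists_le_mul_sqDist (x y : Plane κ) :
    ∃ r > 0, (x.1 0 - y.1 0) ^ 2 + (x.1 1 - y.1 1) ^ 2 ≤ r * sqDist κ x.1 y.1 := by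
  by_cases hκ0 : 0 ≤ κ
  · refine ⟨1, one_pos, ?_⟩
    simp only [sqDist, normalForm, Pi.sub_apply]
    nlinarith [mul_nonneg hκ0 (sq_nonneg (x.1 2 - y.1 2))]
  obtain rfl : κ = -1 := by
    rcases hκ with rfl | rfl | rfl <;> simp_all
  have hx := x.2.1
  have hy := y.2.1
  have hpos := mul_pos (x.2.2 (by norm_num)) (y.2.2 (by norm_num))
  have hx2 : x.1 2 ^ 2 = 1 + (x.1 0 ^ 2 + x.1 1 ^ 2) := by linarith
  have hy2 : y.1 2 ^ 2 = 1 + (y.1 0 ^ 2 + y.1 1 ^ 2) := by linarith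
  have hlt : |x.1 0 * y.1 0 + x.1 1 * y.1 1| < x.1 2 * y.1 2 := by
    refine abs_lt_of_sq_lt_sq ?_ hpos.le
    rw [mul_pow, hx2, hy2]
    nlinarith [sq_nonneg (x.1 0 * y.1 1 - x.1 1 * y.1 0), sq_nonneg (x.1 0), sq_nonneg (x.1 1),
      sq_nonneg (y.1 0), sq_nonneg (y.1 1)]
  refine ⟨(x.1 2 * y.1 2 + (x.1 0 * y.1 0 + x.1 1 * y.1 1) + 1) / 2,
    by linarith [(abs_lt.1 hlt).1], ?_⟩
  have hcross : (x.1 2 * y.1 2 + (x.1 0 * y.1 0 + x.1 1 * y.1 1) + 1) / 2 * sqDist (-1) x.1 y.1 =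
      (x.1 0 - y.1 0) ^ 2 + (x.1 1 - y.1 1) ^ 2 + (x.1 0 * y.1 1 - x.1 1 * y.1 0) ^ 2 := by
    have hB : sqDist (-1) x.1 y.1 = 2 * (pointForm (-1) x.1 y.1 - 1) := by
      linarith [curvature_mul_sqDist (Or.inr (Or.inr rfl)) x y]
    rw [hB, pointForm]
    linear_combination y.1 2 ^ 2 * hx2 + (1 + (x.1 0 ^ 2 + x.1 1 ^ 2)) * hy2
  rw [hcross]
  exact le_add_of_nonneg_right (sq_nonneg _)

theorem sqDist_nonneg (x y : Plane κ) : 0 ≤ sqDist κ x.1 y.1 := by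
  obtain ⟨r, hr, h⟩ := exists_le_mul_sqDist hκ x y
  exact nonneg_of_mul_nonneg_right ((by positivity : (0 : ℝ) ≤ _).trans h) hr

theorem eq_of_sqDist_eq_zero {x y : Plane κ} (h : sqDist κ x.1 y.1 = 0) : x = y := by
  obtain ⟨r, -, hr⟩ := exists_le_mul_sqDist hκ x y
  rw [h, mul_zero] at hr
  have h0 : x.1 0 - y.1 0 = 0 := by nlinarith [sq_nonneg (x.1 1 - y.1 1)]
  have h1 : x.1 1 - y.1 1 = 0 := by nlinarith [sq_nonneg (x.1 0 - y.1 0)]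
  have h2 : x.1 2 - y.1 2 = 0 := by
    simp only [sqDist, normalForm, Pi.sub_apply, h0, h1] at h
    refine pow_eq_zero_iff two_ne_zero |>.1 ?_
    linear_combination κ * h - (x.1 2 - y.1 2) * curvature_sq_mul_sub hκ x y
  refine Subtype.ext (funext fun i => sub_eq_zero.1 ?_)
  fin_cases i <;> assumption

theorem sqDist_pos {x y : Plane κ} (h : x ≠ y) : 0 < sqDist κ x.1 y.1 :=
  (sqDist_nonneg hκ x y).lt_of_ne fun h0 => h (eq_of_sqDist_eq_zero hκ h0.symm)

theorem planeDist_eq_iff (x y x' y' : Plane κ) :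
    planeDist x y = planeDist x' y' ↔ sqDist κ x.1 y.1 = sqDist κ x'.1 y'.1 := by
  have hB := curvature_mul_sqDist hκ x y
  have hB' := curvature_mul_sqDist hκ x' y'
  have hnn := sqDist_nonneg hκ x y
  have hnn' := sqDist_nonneg hκ x' y'
  rcases hκ with rfl | rfl | rfl
  · have hmem (x y : Plane 1) (hB : 1 * sqDist 1 x.1 y.1 = 2 * (1 - pointForm 1 x.1 y.1))
        (hnn : 0 ≤ sqDist 1 x.1 y.1) :
        x.1 0 * y.1 0 + x.1 1 * y.1 1 + x.1 2 * y.1 2 ∈ Set.Icc (-1 : ℝ) 1 := by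
      rw [pointForm] at hB
      exact ⟨by nlinarith [x.2.1, y.2.1, sq_nonneg (x.1 0 + y.1 0), sq_nonneg (x.1 1 + y.1 1),
        sq_nonneg (x.1 2 + y.1 2)], by linarith⟩
    simp only [planeDist, zero_lt_one, if_true]
    rw [Real.arccos_injOn.eq_iff (hmem x y hB hnn) (hmem x' y' hB' hnn')]
    rw [pointForm] at hB hB'
    constructor <;> intro h <;> linarith
  · simp only [planeDist, lt_irrefl, if_false, if_true]
    rw [Real.sqrt_inj (by positivity) (by positivity)]
    simp only [sqDist, normalForm, Pi.sub_apply, zero_mul, add_zero, pow_two]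
  · simp only [planeDist, show ¬(0 : ℝ) < -1 by norm_num, show ¬(-1 : ℝ) = 0 by norm_num, if_false]
    rw [pointForm] at hB hB'
    rw [Real.arcosh_injOn.eq_iff (by rw [Set.mem_Ici]; linarith) (by rw [Set.mem_Ici]; linarith)]
    constructor <;> intro h <;> linarith

theorem sqDist_reflectVec {n : Fin 3 → ℝ} (hn : normalForm κ n n = 1) (x y : Plane κ) :
    sqDist κ (reflectVec κ n x.1) (reflectVec κ n y.1) = sqDist κ x.1 y.1 := by
  have hκ3 : κ ^ 3 = κ := by rcases hκ with rfl | rfl | rfl <;> norm_num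
  simp only [sqDist, normalForm, pairing, Pi.sub_apply, reflectVec_zero, reflectVec_one,
    reflectVec_two] at hn ⊢
  linear_combination 4 * (n 0 * (x.1 0 - y.1 0) + n 1 * (x.1 1 - y.1 1) +
      n 2 * (x.1 2 - y.1 2)) ^ 2 * (hn + n 2 ^ 2 * hκ3) -
    4 * (n 0 * (x.1 0 - y.1 0) + n 1 * (x.1 1 - y.1 1) + n 2 * (x.1 2 - y.1 2)) * n 2 *
      curvature_sq_mul_sub hκ x y

theorem sqDist_reflectVec_self {n : Fin 3 → ℝ} (hn : normalForm κ n n = 1) (v : Fin 3 → ℝ) :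
    sqDist κ v (reflectVec κ n v) = 4 * pairing n v ^ 2 := by
  have hκ3 : κ ^ 3 = κ := by rcases hκ with rfl | rfl | rfl <;> norm_num
  simp only [sqDist, normalForm, Pi.sub_apply, reflectVec_zero, reflectVec_one,
    reflectVec_two] at hn ⊢
  linear_combination 4 * pairing n v ^ 2 * (hn + n 2 ^ 2 * hκ3)

theorem pairing_bisector (x y z : Plane κ) :
    pairing (bisector κ y.1 z.1) x.1 = sqDist κ x.1 z.1 - sqDist κ x.1 y.1 := by
  have hnorm : (normalForm κ y.1 y.1 - normalForm κ z.1 z.1) * (1 - x.1 2) = 0 := by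
    have hx := x.2.1
    have hy := y.2.1
    have hz := z.2.1
    simp only [normalForm]
    rcases hκ with rfl | rfl | rfl
    · linear_combination (1 - x.1 2) * (hy - hz)
    · rw [two_eq_one_of_euclidean x]; ring
    · linear_combination (x.1 2 - 1) * (hy - hz)
  simp only [pairing, bisector, sqDist, normalForm, Pi.sub_apply, Matrix.cons_val_zero,
    Matrix.cons_val_one, Matrix.cons_val_two, Matrix.head_cons, Matrix.tail_cons] at hnorm ⊢
  linear_combination hnorm

/-- Leibniz's relation between the distances from two points to a weighted family of points that
has one of them as barycentre. -/
theorem sqDist_eq_sum {ι : Type*} [Fintype ι] {P : ι → Plane κ} {α : ι → ℝ} {x : Plane κ}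
    (hx : x.1 = ∑ i, α i • (P i).1) (y : Plane κ) :
    sqDist κ x.1 y.1 = ∑ i, α i * (sqDist κ (P i).1 y.1 - sqDist κ (P i).1 x.1) := by
  have h := pairing_bisector hκ x x y
  rw [sqDist_self, sub_zero] at h
  rw [← h]
  conv_lhs => rw [hx, pairing_sum, ← hx]
  simp only [pairing_smul, pairing_bisector hκ]

theorem curvature_mul_sum_sqDist {ι : Type*} [Fintype ι] {P : ι → Plane κ} {α : ι → ℝ}
    {x : Plane κ} (hx : x.1 = ∑ i, α i • (P i).1) :
    κ * ∑ i, α i * sqDist κ (P i).1 x.1 = 2 * (∑ i, α i - 1) := by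
  have hone : ∑ i, α i * pointForm κ (P i).1 x.1 = 1 := by
    simp only [pointForm_comm κ (P _).1, ← pointForm_smul_right, ← pointForm_sum_right]
    rw [← hx, pointForm_self]
  calc κ * ∑ i, α i * sqDist κ (P i).1 x.1
      = ∑ i, (2 * α i - 2 * (α i * pointForm κ (P i).1 x.1)) := by
        rw [Finset.mul_sum]
        refine Finset.sum_congr rfl fun i _ => ?_
        linear_combination α i * curvature_mul_sqDist hκ (P i) x
    _ = 2 * (∑ i, α i - 1) := by
        rw [Finset.sum_sub_distrib, ← Finset.mul_sum, ← Finset.mul_sum, hone]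
        ring

/-- On the sphere, the bound on `κ * R` says that `R` is smaller than the distance from `u` to
its polar great circle. -/
theorem exists_eq_of_le_sqDist {ι : Type*} [Fintype ι] {P : ι → Plane κ} {α : ι → ℝ} {x : Plane κ}
    (hα : ∀ i, 0 ≤ α i) (hx : x.1 = ∑ i, α i • (P i).1) {u : Plane κ} {R : ℝ} (hκR : κ * R < 2)
    (hP : ∀ i, sqDist κ (P i).1 u.1 ≤ R) (hR : R ≤ sqDist κ x.1 u.1) : ∃ i, x = P i := by
  have hleibniz : R - sqDist κ x.1 u.1 = ∑ i, α i * (R - sqDist κ (P i).1 u.1) +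
      (∑ i, α i * sqDist κ (P i).1 x.1) * (1 - κ * R / 2) := by
    have hsum := curvature_mul_sum_sqDist hκ hx
    rw [sqDist_eq_sum hκ hx]
    simp only [mul_sub, Finset.sum_sub_distrib, ← Finset.sum_mul]
    linear_combination R / 2 * hsum
  have hnn : 0 ≤ ∑ i, α i * (R - sqDist κ (P i).1 u.1) :=
    Finset.sum_nonneg fun i _ => mul_nonneg (hα i) (sub_nonneg.2 (hP i))
  have hterm (i : ι) : 0 ≤ α i * sqDist κ (P i).1 x.1 := mul_nonneg (hα i) (sqDist_nonneg hκ _ _)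
  have hzero : ∑ i, α i * sqDist κ (P i).1 x.1 = 0 := by
    nlinarith [Finset.sum_nonneg fun i (_ : i ∈ Finset.univ) => hterm i]
  obtain ⟨i, hi⟩ : ∃ i, α i ≠ 0 := by
    by_contra! hα0
    have hx0 : x.1 = 0 := by simpa [hα0] using hx
    simpa [hx0, pointForm] using pointForm_self x
  have hi0 := (Finset.sum_eq_zero_iff_of_nonneg fun i _ => hterm i).1 hzero i (Finset.mem_univ i)
  exact ⟨i, (eq_of_sqDist_eq_zero hκ ((mul_eq_zero.1 hi0).resolve_left hi)).symm⟩

theorem sqDist_of_add_eq_smul {x y m : Plane κ} {r : ℝ} (h : x.1 + y.1 = (2 * r) • m.1)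
    (hm : sqDist κ x.1 m.1 = sqDist κ y.1 m.1) :
    sqDist κ x.1 y.1 = 2 * (1 + r) * sqDist κ x.1 m.1 := by
  have hL := congrArg (pairing (bisector κ y.1 m.1)) h
  simp only [pairing_add, pairing_smul, pairing_bisector hκ, sqDist_self] at hL
  rw [sqDist_comm m.1 y.1] at hL
  linear_combination -hL - (1 + 2 * r) * hm

/-- Pythagoras' theorem for the triangle `x m z`, in which `m` is the midpoint of `x` and of its
mirror image `y` in the line through `m` and `z`. -/
theorem sqDist_eq_add_of_add_eq_smul {x y m z : Plane κ} {r : ℝ}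
    (h : x.1 + y.1 = (2 * r) • m.1) (hm : sqDist κ x.1 m.1 = sqDist κ y.1 m.1)
    (hz : sqDist κ x.1 z.1 = sqDist κ y.1 z.1) :
    sqDist κ x.1 z.1 = sqDist κ x.1 m.1 + r * sqDist κ m.1 z.1 := by
  have hL := congrArg (pairing (bisector κ z.1 m.1)) h
  simp only [pairing_add, pairing_smul, pairing_bisector hκ, sqDist_self] at hL
  linear_combination -hL / 2 - hm / 2 + hz / 2

end PlaneGeometry

/-! ### Vertices and their stabilisers -/

section Vertices

theorem pos_smul_mem_plane {κ : ℝ} {w : Fin 3 → ℝ} (hw : 0 < pointForm κ w w)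
    (hw2 : κ ≤ 0 → 0 < w 2) : ∃ r : ℝ, 0 < r ∧ ∃ x : Plane κ, x.1 = r • w := by
  have hr : 0 < (√(pointForm κ w w))⁻¹ := inv_pos.2 (Real.sqrt_pos.2 hw)
  have hr2 : (√(pointForm κ w w))⁻¹ ^ 2 * pointForm κ w w = 1 := by
    rw [inv_pow, Real.sq_sqrt hw.le, inv_mul_cancel₀ hw.ne']
  refine ⟨_, hr, ⟨_ • w, ?_, fun hκ => mul_pos hr (hw2 hκ)⟩, rfl⟩
  rw [← hr2, pointForm]
  simp only [Pi.smul_apply, smul_eq_mul]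
  ring

theorem cos_pi_div_pos {n : ℕ} (hn : 3 ≤ n) : 0 < Real.cos (Real.pi / n) := by
  obtain ⟨h1, h2⟩ := pi_div_bounds n hn
  exact Real.cos_pos_of_mem_Ioo ⟨by linarith [Real.pi_pos], h2⟩

variable {p q : ℕ}

theorem curvature_cases : curvature p q = 1 ∨ curvature p q = 0 ∨ curvature p q = -1 := by
  unfold curvature
  split_ifs <;> simp

theorem curvature_eq_zero_of_cos_eq_sin (hp : 3 ≤ p) (hq : 3 ≤ q)
    (h : Real.cos (Real.pi / q) = Real.sin (Real.pi / p)) : curvature p q = 0 := by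
  obtain ⟨hp1, hp2⟩ := pi_div_bounds p hp
  obtain ⟨hq1, hq2⟩ := pi_div_bounds q hq
  rw [← Real.sin_pi_div_two_sub] at h
  have hangle := Real.injOn_sin ⟨by linarith, by linarith⟩ ⟨by linarith, by linarith⟩ h
  have hsum : (1 / p + 1 / q : ℝ) = 1 / 2 := by
    refine mul_left_cancel₀ Real.pi_ne_zero ?_
    linear_combination -hangle
  rw [curvature, if_neg hsum.le.not_gt, if_pos hsum]

instance : Fintype Gen := ⟨⟨{.a, .b, .c}, by simp⟩, by rintro (_ | _ | _) <;> simp⟩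

theorem sum_gen {M : Type*} [AddCommMonoid M] (f : Gen → M) :
    ∑ s, f s = f .a + f .b + f .c := by
  change Multiset.sum (Multiset.map f {.a, .b, .c}) = _
  simp [add_assoc]

variable [hp : Fact (3 ≤ p)]

theorem normalAx_mul_sin : normalAx p q * Real.sin (Real.pi / p) = -Real.cos (Real.pi / q) := by
  rw [normalAx, neg_mul, div_mul_cancel₀ _ (sin_pi_div_pos p hp.out).ne']

variable [hq : Fact (3 ≤ q)]

theorem normalAz_pos : 0 < normalAz p q := by
  rw [normalAz]
  split_ifs with h
  · exact one_pos
  · refine Real.sqrt_pos.2 (abs_pos.2 fun h0 => h ?_)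
    have hx : normalAx p q = -1 := by nlinarith [normalAx_neg p q]
    have hsin := normalAx_mul_sin (p := p) (q := q)
    rw [hx] at hsin
    exact curvature_eq_zero_of_cos_eq_sin hp.out hq.out (by linarith)

variable (p q) in
/-- The vertex of the triangle opposite to the side `s`. -/
noncomputable def vert : Gen → Space p q
  | .a => faceCentre p q
  | .b => edgeMidpoint p q
  | .c => vertexPoint p q

theorem height_vert_self_pos (s : Gen) : 0 < height s (vert p q s) := by
  have hz := normalAz_pos (p := p) (q := q)
  have hs := sin_pi_div_pos p hp.out
  have hs' := sin_pi_div_pos q hq.out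
  cases s
  · simpa [height, vert, pairing, normal, normalA, faceCentre] using hz
  · simpa [height, vert, pairing, normal, normalB, edgeMidpoint] using mul_pos hs hz
  · simpa [height, vert, pairing, normal, normalC, vertexPoint] using
      mul_pos (inv_pos.2 hs') (mul_pos hz hs)

theorem height_vert {s t : Gen} (hst : s ≠ t) : height s (vert p q t) = 0 := by
  cases s <;> cases t <;> first
    | exact absurd rfl hst
    | simp [height, vert, pairing, normal, normalA, normalB, normalC, faceCentre, edgeMidpoint,
        vertexPoint, mul_comm, mul_left_comm]; done
    | simp only [height, vert, pairing, normal, normalA, normalB, vertexPoint, Pi.smul_apply,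
        smul_eq_mul, Matrix.cons_val]; ring

theorem height_vert_nonneg (s t : Gen) : 0 ≤ height s (vert p q t) := by
  by_cases hst : s = t
  · exact hst ▸ (height_vert_self_pos s).le
  · exact (height_vert hst).ge

theorem vert_mem_triangle (t : Gen) : vert p q t ∈ triangle p q :=
  mem_triangle_iff.2 fun s => height_vert_nonneg s t

theorem gen_smul_vert {s t : Gen} (hst : s ≠ t) : gen p q s • vert p q t = vert p q t :=
  gen_smul_eq_self (height_vert hst)

theorem eq_sum_smul_vert (v : Fin 3 → ℝ) :
    v = ∑ s, (pairing (normal p q s) v / height s (vert p q s)) • (vert p q s).1 := by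
  have hz := (normalAz_pos (p := p) (q := q)).ne'
  have hs := (sin_pi_div_pos p hp.out).ne'
  have hs' := (sin_pi_div_pos q hq.out).ne'
  rw [sum_gen]
  funext i
  simp only [height, vert, pairing, normal, normalA, normalB, normalC, faceCentre, edgeMidpoint,
    vertexPoint, Pi.add_apply, Pi.smul_apply, smul_eq_mul, Matrix.cons_val, mul_zero, mul_one,
    zero_mul, zero_add, add_zero, one_mul]
  fin_cases i <;> simp only [Fin.zero_eta, Fin.mk_one, Fin.reduceFinMk, Matrix.cons_val] <;>
    field_simp <;> ring

theorem pointForm_vert_ab :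
    pointForm (curvature p q) (vert p q .a).1 (vert p q .b).1 = -normalAx p q := by
  simp [pointForm, vert, faceCentre, edgeMidpoint]

theorem pointForm_vert_bc :
    pointForm (curvature p q) (vert p q .b).1 (vert p q .c).1 =
      Real.cos (Real.pi / p) / Real.sin (Real.pi / q) := by
  have h := normalA_sq p q
  simp only [pointForm, vert, edgeMidpoint, vertexPoint, Pi.smul_apply, smul_eq_mul,
    Matrix.cons_val]
  linear_combination (Real.sin (Real.pi / q))⁻¹ * Real.cos (Real.pi / p) * h

theorem pointForm_vert_ac :
    pointForm (curvature p q) (vert p q .a).1 (vert p q .c).1 =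
      -normalAx p q * (Real.cos (Real.pi / p) / Real.sin (Real.pi / q)) := by
  simp only [pointForm, vert, faceCentre, vertexPoint, Pi.smul_apply, smul_eq_mul, Matrix.cons_val]
  ring

theorem pointForm_vert_pos (s t : Gen) :
    0 < pointForm (curvature p q) (vert p q s).1 (vert p q t).1 := by
  have hx : 0 < -normalAx p q := neg_pos.2 (normalAx_neg p q)
  have hd := div_pos (cos_pi_div_pos hp.out) (sin_pi_div_pos q hq.out)
  have hab := hx.trans_eq (pointForm_vert_ab (p := p) (q := q)).symm
  have hbc := hd.trans_eq pointForm_vert_bc.symm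
  have hac := (mul_pos hx hd).trans_eq pointForm_vert_ac.symm
  have hself (s) : 0 < pointForm (curvature p q) (vert p q s).1 (vert p q s).1 :=
    (pointForm_self _).symm ▸ one_pos
  cases s <;> cases t <;> first
    | exact hself _
    | assumption
    | exact pointForm_comm _ _ _ ▸ ‹_›

theorem exists_forall_height_pos : ∃ x : Space p q, ∀ s, 0 < height s x := by
  have hform : 0 < pointForm (curvature p q) (∑ s, (vert p q s).1) (∑ t, (vert p q t).1) := by
    rw [pointForm_sum_right]
    refine Finset.sum_pos (fun t _ => ?_) ⟨.a, Finset.mem_univ _⟩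
    rw [pointForm_comm, pointForm_sum_right]
    exact Finset.sum_pos (fun s _ => pointForm_vert_pos t s) ⟨.a, Finset.mem_univ _⟩
  obtain ⟨r, hr, x, hx⟩ := pos_smul_mem_plane hform fun hκ => by
    rw [Finset.sum_apply]
    exact Finset.sum_pos (fun s _ => (vert p q s).2.2 hκ) ⟨.a, Finset.mem_univ _⟩
  refine ⟨x, fun s => ?_⟩
  rw [height, hx, pairing_smul, pairing_sum]
  exact mul_pos hr (Finset.sum_pos' (fun t _ => height_vert_nonneg s t)
    ⟨s, Finset.mem_univ s, height_vert_self_pos s⟩)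

theorem curvature_mul_sqDist_vert_lt (s t : Gen) :
    curvature p q * sqDist (curvature p q) (vert p q s).1 (vert p q t).1 < 2 := by
  rw [curvature_mul_sqDist curvature_cases]
  linarith [pointForm_vert_pos (p := p) (q := q) s t]

variable (p q) in
/-- The stabiliser of a vertex of the triangle. The images of the triangle under it form a tile
with that vertex as centre. -/
noncomputable abbrev vertStabilizer (t : Gen) : Subgroup (CoxeterG p q) :=
  MulAction.stabilizer (CoxeterG p q) (vert p q t)

theorem vertStabilizer_eq (t : Gen) :
    vertStabilizer p q t = Subgroup.closure (gen p q '' {t}ᶜ) := by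
  have hzero : {s | height s (vert p q t) = 0} = {t}ᶜ := by
    ext s
    refine ⟨fun h hst => ?_, height_vert⟩
    rw [hst] at h
    exact (height_vert_self_pos t).ne' h
  rw [vertStabilizer, isReflectionHeight_height.stabilizer_eq_closure (fun _ _ => gen_smul_eq_self)
    fun s => height_vert_nonneg s t, hzero]
  rfl

theorem vertStabilizer_a : vertStabilizer p q .a = Subgroup.closure {genB p q, genC p q} := by
  have hcompl : ({.a}ᶜ : Set Gen) = {.b, .c} := by ext (_ | _ | _) <;> simp
  rw [vertStabilizer_eq, hcompl, Set.image_pair]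
  rfl

theorem vertStabilizer_b : vertStabilizer p q .b = Subgroup.closure {genA p q, genC p q} := by
  have hcompl : ({.b}ᶜ : Set Gen) = {.a, .c} := by ext (_ | _ | _) <;> simp
  rw [vertStabilizer_eq, hcompl, Set.image_pair]
  rfl

theorem vertStabilizer_c : vertStabilizer p q .c = Subgroup.closure {genA p q, genB p q} := by
  have hcompl : ({.c}ᶜ : Set Gen) = {.a, .b} := by ext (_ | _ | _) <;> simp
  rw [vertStabilizer_eq, hcompl, Set.image_pair]
  rfl

end Vertices

/-! ### Symmetries of the tiles -/

section Isometries

variable {p q : ℕ}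

theorem sqDist_apply {f : Equiv.Perm (Space p q)} (hf : f ∈ isometryGroup (curvature p q))
    (x y : Space p q) :
    sqDist (curvature p q) (f x).1 (f y).1 = sqDist (curvature p q) x.1 y.1 :=
  (planeDist_eq_iff curvature_cases _ _ _ _).1 (hf x y)

variable [Fact (3 ≤ p)] [Fact (3 ≤ q)]

theorem toPerm_mem_isometryGroup (g : CoxeterG p q) :
    toPerm p q g ∈ isometryGroup (curvature p q) := by
  induction g using (coxeterSystem p q).simple_induction with
  | simple s =>
    intro x y
    change planeDist (gen p q s • x) (gen p q s • y) = _
    rw [planeDist_eq_iff curvature_cases, coe_gen_smul, coe_gen_smul,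
      sqDist_reflectVec curvature_cases (normalForm_normal_self p q s)]
  | one => simp
  | mul g h hg hh => exact map_mul (toPerm p q) g h ▸ mul_mem hg hh

theorem sqDist_smul (g : CoxeterG p q) (x y : Space p q) :
    sqDist (curvature p q) (g • x).1 (g • y).1 = sqDist (curvature p q) x.1 y.1 :=
  sqDist_apply (toPerm_mem_isometryGroup g) x y

theorem eq_of_sqDist_vert_eq {y z : Space p q} (h : ∀ s, sqDist (curvature p q) (vert p q s).1 y.1 =
    sqDist (curvature p q) (vert p q s).1 z.1) : y = z := by
  refine eq_of_sqDist_eq_zero curvature_cases ?_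
  rw [sqDist_eq_sum curvature_cases (eq_sum_smul_vert y.1)]
  exact Finset.sum_eq_zero fun s _ => by rw [h s, sub_self, mul_zero]

theorem sqDist_mul_height_vert {s : Gen} {y z : Space p q}
    (h : ∀ t ≠ s, sqDist (curvature p q) (vert p q t).1 y.1 =
      sqDist (curvature p q) (vert p q t).1 z.1) :
    sqDist (curvature p q) y.1 z.1 * height s (vert p q s) =
      (sqDist (curvature p q) (vert p q s).1 z.1 - sqDist (curvature p q) (vert p q s).1 y.1) *
        height s y := by
  have hpos := height_vert_self_pos (p := p) (q := q) s
  rw [sqDist_eq_sum curvature_cases (eq_sum_smul_vert y.1), Fintype.sum_eq_single s fun t hts => by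
    rw [h t hts, sub_self, mul_zero], ← height]
  field_simp

theorem eq_of_height_eq {s : Gen} {y z : Space p q}
    (h : ∀ t ≠ s, sqDist (curvature p q) (vert p q t).1 y.1 =
      sqDist (curvature p q) (vert p q t).1 z.1) (hs : height s y = height s z) : y = z := by
  have hyz := sqDist_mul_height_vert h
  have hzy := sqDist_mul_height_vert fun t hts => (h t hts).symm
  rw [sqDist_comm z.1, ← hs] at hzy
  have hzero : sqDist (curvature p q) y.1 z.1 * height s (vert p q s) = 0 := by linarith
  exact eq_of_sqDist_eq_zero curvature_cases
    ((mul_eq_zero.1 hzero).resolve_right (height_vert_self_pos s).ne')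

theorem height_gen_smul_self (s : Gen) (x : Space p q) : height s (gen p q s • x) = -height s x :=
  isReflectionHeight_height.simple_smul s x

theorem sqDist_vert_gen_smul {s t : Gen} (hts : t ≠ s) (x : Space p q) :
    sqDist (curvature p q) (vert p q t).1 (gen p q s • x).1 =
      sqDist (curvature p q) (vert p q t).1 x.1 := by
  conv_lhs => rw [← gen_smul_vert hts.symm]
  exact sqDist_smul _ _ _

theorem eq_or_eq_gen_smul {s : Gen} {y z : Space p q}
    (h : ∀ t ≠ s, sqDist (curvature p q) (vert p q t).1 y.1 =
      sqDist (curvature p q) (vert p q t).1 z.1) : z = y ∨ z = gen p q s • y := by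
  refine or_iff_not_imp_left.2 fun hne => (eq_of_height_eq (s := s) (fun t hts => ?_) ?_).symm
  · rw [sqDist_vert_gen_smul hts, h t hts]
  have hyz := sqDist_mul_height_vert h
  have hzy := sqDist_mul_height_vert fun t hts => (h t hts).symm
  have hpos : 0 < sqDist (curvature p q) y.1 z.1 * height s (vert p q s) :=
    mul_pos (sqDist_pos curvature_cases (Ne.symm hne)) (height_vert_self_pos s)
  have hdiff : sqDist (curvature p q) (vert p q s).1 z.1 -
      sqDist (curvature p q) (vert p q s).1 y.1 ≠ 0 := by
    intro h0
    rw [hyz, h0, zero_mul] at hpos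
    exact hpos.false
  rw [sqDist_comm z.1] at hzy
  rw [height_gen_smul_self]
  refine mul_left_cancel₀ hdiff ?_
  linear_combination hyz - hzy

theorem eq_one_of_apply_vert {f : Equiv.Perm (Space p q)} (hf : f ∈ isometryGroup (curvature p q))
    (h : ∀ s, f (vert p q s) = vert p q s) : f = 1 := by
  refine Equiv.ext fun x => eq_of_sqDist_vert_eq fun s => ?_
  conv_lhs => rw [← h s]
  exact sqDist_apply hf _ _

theorem eq_one_or_eq_toPerm_gen {f : Equiv.Perm (Space p q)}
    (hf : f ∈ isometryGroup (curvature p q)) {s : Gen} (h : ∀ t ≠ s, f (vert p q t) = vert p q t) :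
    f = 1 ∨ f = toPerm p q (gen p q s) := by
  have hdist (t : Gen) (hts : t ≠ s) : sqDist (curvature p q) (vert p q t).1 (vert p q s).1 =
      sqDist (curvature p q) (vert p q t).1 (f (vert p q s)).1 := by
    conv_rhs => rw [← h t hts]
    exact (sqDist_apply hf _ _).symm
  refine (eq_or_eq_gen_smul hdist).imp (fun hs => ?_) fun hs => ?_
  · refine eq_one_of_apply_vert hf fun t => ?_
    by_cases hts : t = s
    exacts [hts ▸ hs, h t hts]
  · rw [eq_comm, ← inv_mul_eq_one, ← map_inv]
    refine eq_one_of_apply_vert (mul_mem (toPerm_mem_isometryGroup _) hf) fun t => ?_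
    change (gen p q s)⁻¹ • f (vert p q t) = vert p q t
    by_cases hts : t = s
    · rw [hts, hs, inv_smul_smul]
    · rw [h t hts, inv_smul_eq_iff, gen_smul_vert (Ne.symm hts)]

end Isometries

section TileSymmetries

theorem finite_closure_pair {G : Type*} [Group G] {s t : G} (hs : s * s = 1) (ht : t * t = 1)
    (hst : IsOfFinOrder (s * t)) : Finite (Subgroup.closure {s, t}) := by
  have hfin : (Subgroup.zpowers (s * t) : Set G).Finite := finite_zpowers.2 hst
  refine (hfin.union (hfin.preimage (mul_right_injective s).injOn)).subset fun g hg => ?_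
  change g ∈ Subgroup.zpowers (s * t) ∨ s * g ∈ Subgroup.zpowers (s * t)
  have hmem := Subgroup.mem_zpowers (s * t)
  have mul_s {g : G} (hg : g ∈ Subgroup.zpowers (s * t) ∨ s * g ∈ Subgroup.zpowers (s * t)) :
      s * g ∈ Subgroup.zpowers (s * t) ∨ s * (s * g) ∈ Subgroup.zpowers (s * t) := by
    rwa [← mul_assoc, hs, one_mul, or_comm]
  have mul_t {g : G} (hg : g ∈ Subgroup.zpowers (s * t) ∨ s * g ∈ Subgroup.zpowers (s * t)) :
      t * g ∈ Subgroup.zpowers (s * t) ∨ s * (t * g) ∈ Subgroup.zpowers (s * t) := by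
    rw [← mul_assoc, Subgroup.mul_mem_cancel_left _ hmem]
    have htg : t * g = (s * t)⁻¹ * (s * g) := by
      rw [mul_inv_rev, mul_assoc, inv_mul_cancel_left, ← eq_inv_of_mul_eq_one_left ht]
    rwa [htg, Subgroup.mul_mem_cancel_left _ (inv_mem hmem), or_comm]
  induction hg using Subgroup.closure_induction_left with
  | one => exact Or.inl (one_mem _)
  | mul_left x hx y _ hy =>
    rcases hx with rfl | rfl
    exacts [mul_s hy, mul_t hy]
  | inv_mul_cancel x hx y _ hy =>
    rcases hx with rfl | rfl
    · exact eq_inv_of_mul_eq_one_left hs ▸ mul_s hy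
    · exact eq_inv_of_mul_eq_one_left ht ▸ mul_t hy

variable {p q : ℕ} [hp : Fact (3 ≤ p)] [hq : Fact (3 ≤ q)]

theorem exists_forall_ne_eq_or_eq {t u : Gen} (h : t ≠ u) : ∃ s, ∀ r ≠ s, r = t ∨ r = u := by
  cases t <;> cases u <;> first
    | exact absurd rfl h
    | refine ⟨.a, ?_⟩; rintro (_ | _ | _) <;> simp; done
    | refine ⟨.b, ?_⟩; rintro (_ | _ | _) <;> simp; done
    | refine ⟨.c, ?_⟩; rintro (_ | _ | _) <;> simp

theorem finite_closure_gen_pair {s t : Gen} (hst : coxeterMatrix p q s t ≠ 0) :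
    Finite (Subgroup.closure {gen p q s, gen p q t}) :=
  finite_closure_pair ((coxeterSystem p q).simple_mul_simple_self s)
    ((coxeterSystem p q).simple_mul_simple_self t) <|
    isOfFinOrder_iff_pow_eq_one.2
      ⟨_, hst.bot_lt, (coxeterSystem p q).simple_mul_simple_pow s t⟩

instance finite_vertStabilizer (u : Gen) : Finite (vertStabilizer p q u) := by
  have hp0 : p ≠ 0 := (three_pos.trans_le hp.out).ne'
  have hq0 : q ≠ 0 := (three_pos.trans_le hq.out).ne'
  cases u
  · exact vertStabilizer_a (p := p) (q := q) ▸ finite_closure_gen_pair (s := .b) (t := .c) hp0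
  · exact vertStabilizer_b (p := p) (q := q) ▸
      finite_closure_gen_pair (s := .a) (t := .c) two_ne_zero
  · exact vertStabilizer_c (p := p) (q := q) ▸ finite_closure_gen_pair (s := .a) (t := .b) hq0

theorem pointForm_smul (g : CoxeterG p q) (x y : Space p q) :
    pointForm (curvature p q) (g • x).1 (g • y).1 = pointForm (curvature p q) x.1 y.1 := by
  have hgxy := curvature_mul_sqDist curvature_cases (g • x) (g • y)
  rw [sqDist_smul, curvature_mul_sqDist curvature_cases] at hgxy
  linarith

variable {u : Gen}

theorem smul_vert_of_mem {d : CoxeterG p q} (hd : d ∈ vertStabilizer p q u) :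
    d • vert p q u = vert p q u := hd

theorem sqDist_smul_vert {d : CoxeterG p q} (hd : d ∈ vertStabilizer p q u) (x : Space p q) :
    sqDist (curvature p q) (d • x).1 (vert p q u).1 =
      sqDist (curvature p q) x.1 (vert p q u).1 := by
  conv_lhs => rw [← smul_vert_of_mem hd]
  exact sqDist_smul d x _

theorem sum_height_vertStabilizer_smul [Fintype (vertStabilizer p q u)] {s : Gen} (hsu : s ≠ u)
    (x : Space p q) : ∑ d : vertStabilizer p q u, height s (d.1 • x) = 0 := by
  have hneg := Equiv.sum_comp (Equiv.mulLeft (⟨gen p q s, gen_smul_vert hsu⟩ :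
    vertStabilizer p q u)) fun d => height s (d.1 • x)
  simp only [Equiv.coe_mulLeft, Subgroup.coe_mul, mul_smul, height_gen_smul_self,
    Finset.sum_neg_distrib] at hneg
  linarith

theorem exists_sum_smul_eq_smul_vert [Fintype (vertStabilizer p q u)] (x : Space p q) :
    ∃ μ : ℝ, ∑ d : vertStabilizer p q u, (d.1 • x).1 = μ • (vert p q u).1 := by
  have hsum := eq_sum_smul_vert (p := p) (q := q) (∑ d : vertStabilizer p q u, (d.1 • x).1)
  rw [Fintype.sum_eq_single u fun s hsu => by
    rw [pairing_sum, show ∑ d : vertStabilizer p q u, pairing (normal p q s) (d.1 • x).1 = 0 from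
      sum_height_vertStabilizer_smul hsu x, zero_div, zero_smul]] at hsum
  exact ⟨_, hsum⟩

theorem exists_vert_eq_sum_smul [Fintype (vertStabilizer p q u)] {x : Space p q}
    (hx : 0 < pointForm (curvature p q) (vert p q u).1 x.1) :
    ∃ α : ℝ, 0 < α ∧ (vert p q u).1 = ∑ d : vertStabilizer p q u, α • (d.1 • x).1 := by
  obtain ⟨μ, hμ⟩ := exists_sum_smul_eq_smul_vert (u := u) x
  have hform := congrArg (pointForm (curvature p q) (vert p q u).1) hμ
  rw [pointForm_sum_right, pointForm_smul_right, pointForm_self, mul_one] at hform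
  have hpos : 0 < μ := by
    rw [← hform]
    refine Finset.sum_pos (fun d _ => ?_) Finset.univ_nonempty
    have hd := pointForm_smul d.1 (vert p q u) x
    rw [smul_vert_of_mem d.2] at hd
    exact hx.trans_eq hd.symm
  exact ⟨μ⁻¹, inv_pos.2 hpos, by rw [← Finset.smul_sum, hμ, inv_smul_smul₀ hpos.ne']⟩

/-- The images of `x` under the stabiliser of `u` lie on a circle around `u`, and `u` is their
barycentre, so no disc with another centre and the same radius contains all of them. -/
theorem eq_vert_of_sqDist_smul_le {x c : Space p q}
    (hx : 0 < pointForm (curvature p q) (vert p q u).1 x.1)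
    (h : ∀ d ∈ vertStabilizer p q u,
      sqDist (curvature p q) (d • x).1 c.1 ≤ sqDist (curvature p q) x.1 (vert p q u).1) :
    c = vert p q u := by
  have := Fintype.ofFinite (vertStabilizer p q u)
  obtain ⟨α, hα, hsum⟩ := exists_vert_eq_sum_smul hx
  refine (eq_of_sqDist_eq_zero curvature_cases
    (le_antisymm ?_ (sqDist_nonneg curvature_cases _ _))).symm
  rw [sqDist_eq_sum (P := fun d : vertStabilizer p q u => d.1 • x) (α := fun _ => α)
    curvature_cases hsum]
  refine Finset.sum_nonpos fun d _ => mul_nonpos_of_nonneg_of_nonpos hα.le (sub_nonpos.2 ?_)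
  exact (h d.1 d.2).trans_eq (sqDist_smul_vert d.2 x).symm

variable {t : Gen}

variable (p q) in
/-- Among the vertices of the triangle, `t` is the only one that is farthest from `u`. In the tile
with centre `u`, the images of `t` are then the only points that are farthest from `u`. -/
def IsFarthestVert (t u : Gen) : Prop :=
  ∀ r ≠ t, sqDist (curvature p q) (vert p q r).1 (vert p q u).1 <
    sqDist (curvature p q) (vert p q t).1 (vert p q u).1

theorem IsFarthestVert.ne (htu : IsFarthestVert p q t u) : t ≠ u := by
  rintro rfl
  obtain ⟨r, hrt⟩ : ∃ r, r ≠ t := by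
    cases t
    exacts [⟨.b, by simp⟩, ⟨.c, by simp⟩, ⟨.a, by simp⟩]
  refine (htu r hrt).not_ge ?_
  rw [sqDist_self]
  exact sqDist_nonneg curvature_cases _ _

theorem IsFarthestVert.eq_vert_of_sqDist_le (htu : IsFarthestVert p q t u) {x : Space p q}
    (hx : x ∈ triangle p q)
    (hle : sqDist (curvature p q) (vert p q t).1 (vert p q u).1 ≤
      sqDist (curvature p q) x.1 (vert p q u).1) : x = vert p q t := by
  have hvert (r : Gen) : sqDist (curvature p q) (vert p q r).1 (vert p q u).1 ≤
      sqDist (curvature p q) (vert p q t).1 (vert p q u).1 := by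
    by_cases hrt : r = t
    exacts [hrt ▸ le_rfl, (htu r hrt).le]
  obtain ⟨r, rfl⟩ := exists_eq_of_le_sqDist curvature_cases
    (fun s => div_nonneg (mem_triangle_iff.1 hx s) (height_vert_self_pos s).le)
    (eq_sum_smul_vert x.1) (curvature_mul_sqDist_vert_lt t u) hvert hle
  by_contra hne
  exact (htu r fun h => hne (h ▸ rfl)).not_ge hle

theorem IsFarthestVert.sqDist_le (htu : IsFarthestVert p q t u) {x : Space p q}
    (hx : x ∈ triangle p q) :
    sqDist (curvature p q) x.1 (vert p q u).1 ≤
      sqDist (curvature p q) (vert p q t).1 (vert p q u).1 := by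
  by_contra! hlt
  exact hlt.ne' (by rw [htu.eq_vert_of_sqDist_le hx hlt.le])

theorem mem_patch {D : Subgroup (CoxeterG p q)} {x : Space p q} :
    x ∈ patch D ↔ ∃ d ∈ D, ∃ y ∈ triangle p q, d • y = x := by
  simp only [patch, Set.mem_iUnion, Set.mem_smul_set, exists_prop]

theorem IsFarthestVert.apply_vert_eq (htu : IsFarthestVert p q t u) {f : Equiv.Perm (Space p q)}
    (hf : f ∈ isometryGroup (curvature p q))
    (hfP : f • patch (vertStabilizer p q u) = patch (vertStabilizer p q u)) :
    f (vert p q u) = vert p q u := by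
  refine eq_vert_of_sqDist_smul_le (pointForm_vert_pos u t) fun d hd => ?_
  have hmem : d • vert p q t ∈ patch (vertStabilizer p q u) :=
    mem_patch.2 ⟨d, hd, _, vert_mem_triangle t, rfl⟩
  rw [← hfP] at hmem
  obtain ⟨x, hx, hfx⟩ := hmem
  obtain ⟨d', hd', y, hy, rfl⟩ := mem_patch.1 hx
  rw [← hfx]
  exact (sqDist_apply hf _ _).trans_le
    ((sqDist_smul_vert hd' y).trans_le (htu.sqDist_le hy))

theorem IsFarthestVert.mem_transformationGroup (htu : IsFarthestVert p q t u)
    {f : Equiv.Perm (Space p q)} (hf : f ∈ isometryGroup (curvature p q))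
    (hfP : f • patch (vertStabilizer p q u) = patch (vertStabilizer p q u)) :
    f ∈ transformationGroup p q := by
  have hfu := htu.apply_vert_eq hf hfP
  have hft : f (vert p q t) ∈ patch (vertStabilizer p q u) := by
    rw [← hfP]
    exact Set.smul_mem_smul_set (mem_patch.2 ⟨1, one_mem _, _, vert_mem_triangle t, one_smul _ _⟩)
  obtain ⟨d, hd, y, hy, hdy⟩ := mem_patch.1 hft
  have hyt : y = vert p q t := by
    refine htu.eq_vert_of_sqDist_le hy (Eq.ge ?_)
    rw [← sqDist_smul_vert hd, hdy]
    conv_lhs => rw [← hfu]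
    exact sqDist_apply hf _ _
  have hdf : (toPerm p q d)⁻¹ * f ∈ isometryGroup (curvature p q) :=
    mul_mem (inv_mem (toPerm_mem_isometryGroup d)) hf
  have hdft : ((toPerm p q d)⁻¹ * f) (vert p q t) = vert p q t :=
    Equiv.Perm.inv_eq_iff_eq.2 (hyt ▸ hdy).symm
  have hdfu : ((toPerm p q d)⁻¹ * f) (vert p q u) = vert p q u :=
    Equiv.Perm.inv_eq_iff_eq.2 (hfu.trans hd.symm)
  obtain ⟨s, hs⟩ := exists_forall_ne_eq_or_eq htu.ne
  have hfix (r : Gen) (hrs : r ≠ s) : ((toPerm p q d)⁻¹ * f) (vert p q r) = vert p q r := by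
    rcases hs r hrs with rfl | rfl
    exacts [hdft, hdfu]
  rw [← mul_inv_cancel_left (toPerm p q d) f]
  refine mul_mem ⟨d, rfl⟩ ?_
  rcases eq_one_or_eq_toPerm_gen hdf hfix with h | h
  · exact h ▸ one_mem _
  · exact h ▸ ⟨_, rfl⟩

end TileSymmetries

section SideLengths

variable {p q : ℕ} [hp : Fact (3 ≤ p)] [hq : Fact (3 ≤ q)]

theorem vert_injective : Function.Injective (vert p q) := fun s t h => by
  by_contra hst
  exact (height_vert_self_pos s).ne' (h ▸ height_vert hst)

theorem pointForm_vert_b_gen_smul {s : Gen} (hs : s ≠ .b) :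
    pointForm (curvature p q) (vert p q .b).1 (gen p q s • vert p q s).1 =
      pointForm (curvature p q) (vert p q .b).1 (vert p q s).1 := by
  conv_lhs => rw [← gen_smul_vert hs]
  exact pointForm_smul _ _ _

/-- Since the angle at `vert p q .b` is right, that vertex is the foot of the perpendiculars from
the other two vertices to the opposite sides. -/
theorem vert_add_gen_smul_vert {s : Gen} (hs : s ≠ .b) :
    (vert p q s).1 + (gen p q s • vert p q s).1 =
      (2 * pointForm (curvature p q) (vert p q .b).1 (vert p q s).1) • (vert p q .b).1 := by
  have hheight (r : Gen) (hr : r ≠ .b) :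
      pairing (normal p q r) ((vert p q s).1 + (gen p q s • vert p q s).1) = 0 := by
    rw [pairing_add]
    change height r (vert p q s) + height r (gen p q s • vert p q s) = 0
    by_cases hrs : r = s
    · rw [hrs, height_gen_smul_self, add_neg_cancel]
    · have hright : coxeterMatrix p q r s = 2 := by
        cases r <;> cases s <;> first | rfl | contradiction
      rw [← coxeterSystem_simple, isReflectionHeight_height, height_vert hrs, hright]
      simp
  have hsum := eq_sum_smul_vert (p := p) (q := q) ((vert p q s).1 + (gen p q s • vert p q s).1)
  rw [Fintype.sum_eq_single .b fun r hr => by rw [hheight r hr, zero_div, zero_smul]] at hsum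
  have hform := congrArg (pointForm (curvature p q) (vert p q .b).1) hsum
  rw [pointForm_smul_right, pointForm_self, mul_one, pointForm_eq_pairing, pairing_add,
    ← pointForm_eq_pairing, ← pointForm_eq_pairing, pointForm_vert_b_gen_smul hs,
    ← two_mul] at hform
  rw [hform]
  exact hsum

theorem sqDist_gen_smul_vert {s t : Gen} (hst : s ≠ t) :
    sqDist (curvature p q) (vert p q s).1 (vert p q t).1 =
      sqDist (curvature p q) (gen p q s • vert p q s).1 (vert p q t).1 := by
  conv_rhs => rw [← gen_smul_vert hst]
  exact (sqDist_smul _ _ _).symm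

theorem sqDist_vert_eq_add {s t : Gen} (hs : s ≠ .b) (hst : s ≠ t) :
    sqDist (curvature p q) (vert p q s).1 (vert p q t).1 =
      sqDist (curvature p q) (vert p q s).1 (vert p q .b).1 +
        pointForm (curvature p q) (vert p q .b).1 (vert p q s).1 *
          sqDist (curvature p q) (vert p q .b).1 (vert p q t).1 :=
  sqDist_eq_add_of_add_eq_smul curvature_cases (vert_add_gen_smul_vert hs)
    (sqDist_gen_smul_vert hs) (sqDist_gen_smul_vert hst)

theorem sqDist_vert_lt_hypotenuse {s t : Gen} (hs : s ≠ .b) (ht : t ≠ .b) (hst : s ≠ t) :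
    sqDist (curvature p q) (vert p q .b).1 (vert p q s).1 <
      sqDist (curvature p q) (vert p q t).1 (vert p q s).1 := by
  rw [sqDist_comm (vert p q t).1, sqDist_vert_eq_add hs hst, sqDist_comm (vert p q .b).1]
  exact lt_add_of_pos_right _ (mul_pos (pointForm_vert_pos _ _)
    (sqDist_pos curvature_cases (vert_injective.ne ht.symm)))

theorem four_mul_height_vert_sq {s : Gen} (hs : s ≠ .b) :
    4 * height s (vert p q s) ^ 2 =
      2 * (1 + pointForm (curvature p q) (vert p q .b).1 (vert p q s).1) *
        sqDist (curvature p q) (vert p q s).1 (vert p q .b).1 := by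
  rw [← sqDist_of_add_eq_smul curvature_cases (vert_add_gen_smul_vert hs) (sqDist_gen_smul_vert hs),
    coe_gen_smul, sqDist_reflectVec_self curvature_cases (normalForm_normal_self p q s), height]

theorem eq_of_sin_pi_div_eq {m n : ℕ} (hm : 3 ≤ m) (hn : 3 ≤ n)
    (h : Real.sin (Real.pi / m) = Real.sin (Real.pi / n)) : m = n := by
  have hpi := Real.pi_pos
  have hm' := pi_div_bounds m hm
  have hn' := pi_div_bounds n hn
  have hdiv := Real.injOn_sin ⟨by linarith, hm'.2.le⟩ ⟨by linarith, hn'.2.le⟩ h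
  exact Nat.cast_injective (inv_injective (mul_left_cancel₀ hpi.ne' hdiv))

/-- Legs of equal length would make the triangle symmetric, hence its heights and thereby its
angles equal. -/
theorem sqDist_vert_ne (hpq : p ≠ q) :
    sqDist (curvature p q) (vert p q .a).1 (vert p q .b).1 ≠
      sqDist (curvature p q) (vert p q .c).1 (vert p q .b).1 := by
  intro heq
  have hpos : sqDist (curvature p q) (vert p q .c).1 (vert p q .b).1 ≠ 0 :=
    (sqDist_pos curvature_cases (vert_injective.ne (by simp))).ne'
  have hform : pointForm (curvature p q) (vert p q .b).1 (vert p q .a).1 =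
      pointForm (curvature p q) (vert p q .b).1 (vert p q .c).1 := by
    have hac := sqDist_vert_eq_add (p := p) (q := q) (s := .a) (t := .c) (by simp) (by simp)
    have hca := sqDist_vert_eq_add (p := p) (q := q) (s := .c) (t := .a) (by simp) (by simp)
    rw [sqDist_comm (vert p q .b).1, heq] at hac hca
    refine mul_right_cancel₀ hpos ?_
    rw [sqDist_comm (vert p q .c).1 (vert p q .a).1] at hca
    linarith
  have hheight : height .a (vert p q .a) = height .c (vert p q .c) := by
    refine (sq_eq_sq₀ (height_vert_self_pos _).le (height_vert_self_pos _).le).1 ?_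
    have ha := four_mul_height_vert_sq (p := p) (q := q) (s := .a) (by simp)
    rw [hform, heq, ← four_mul_height_vert_sq (by simp)] at ha
    linarith
  have hsin : Real.sin (Real.pi / p) = Real.sin (Real.pi / q) := by
    have hq0 := (sin_pi_div_pos q hq.out).ne'
    have hz := (normalAz_pos (p := p) (q := q)).ne'
    have ha : height .a (vert p q .a) = normalAz p q := by
      simp [height, normal, vert, faceCentre, pairing, normalA]
    have hc : height .c (vert p q .c) =
        (Real.sin (Real.pi / q))⁻¹ * (normalAz p q * Real.sin (Real.pi / p)) := by
      simp [height, normal, vert, vertexPoint, pairing, normalC]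
    rw [ha, hc] at hheight
    field_simp at hheight
    exact hheight.symm
  exact hpq (eq_of_sin_pi_div_eq hp.out hq.out hsin)

theorem isFarthestVert_of_ne {t u : Gen} (ht : t ≠ .b) (hu : u ≠ .b) (htu : t ≠ u) :
    IsFarthestVert p q t u := by
  intro r hrt
  have hr : r = .b ∨ r = u := by
    cases r <;> cases u <;> cases t <;> simp_all
  rcases hr with rfl | rfl
  · exact sqDist_vert_lt_hypotenuse hu ht htu.symm
  · rw [sqDist_self]
    exact sqDist_pos curvature_cases (vert_injective.ne htu)

theorem exists_isFarthestVert (u : Gen) (hu : u = .b → p ≠ q) : ∃ t, IsFarthestVert p q t u := by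
  have hpos {t : Gen} (ht : t ≠ .b) : sqDist (curvature p q) (vert p q .b).1 (vert p q .b).1 <
      sqDist (curvature p q) (vert p q t).1 (vert p q .b).1 := by
    rw [sqDist_self]
    exact sqDist_pos curvature_cases (vert_injective.ne ht)
  cases u
  · exact ⟨.c, isFarthestVert_of_ne (by simp) (by simp) (by simp)⟩
  · rcases (sqDist_vert_ne (hu rfl)).lt_or_gt with hlt | hlt
    · refine ⟨.c, ?_⟩
      rintro (_ | _ | _) hr
      exacts [hlt, hpos (by simp), absurd rfl hr]
    · refine ⟨.a, ?_⟩
      rintro (_ | _ | _) hr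
      exacts [absurd rfl hr, hpos (by simp), hlt]
  · exact ⟨.a, isFarthestVert_of_ne (by simp) (by simp) (by simp)⟩

end SideLengths

/-! ### Tilings and colourings -/

section Tiles

variable {p q : ℕ} [hp : Fact (3 ≤ p)] [hq : Fact (3 ≤ q)] {D : Subgroup (CoxeterG p q)}

theorem smul_patch_of_mem {g : CoxeterG p q} (hg : g ∈ D) : g • patch D = patch D := by
  have hsub {g : CoxeterG p q} (hg : g ∈ D) : g • patch D ⊆ patch D := by
    rintro _ ⟨x, hx, rfl⟩
    obtain ⟨d, hd, y, hy, rfl⟩ := mem_patch.1 hx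
    exact mem_patch.2 ⟨g * d, mul_mem hg hd, y, hy, mul_smul _ _ _⟩
  refine (hsub hg).antisymm ?_
  rw [Set.subset_smul_set_iff]
  exact hsub (inv_mem hg)

theorem smul_triangle_subset_smul_patch {g h : CoxeterG p q} :
    g • triangle p q ⊆ h • patch D ↔ h⁻¹ * g ∈ D := by
  rw [Set.subset_smul_set_iff, ← mul_smul]
  refine ⟨fun hsub => ?_, fun hd => ?_⟩
  · obtain ⟨x, hx⟩ := exists_forall_height_pos (p := p) (q := q)
    obtain ⟨d, hd, y, hy, hdy⟩ := mem_patch.1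
      (hsub (Set.smul_mem_smul_set (mem_triangle_iff.2 fun s => (hx s).le)))
    have hyx : (d⁻¹ * (h⁻¹ * g)) • x = y := by rw [mul_smul, ← hdy, inv_smul_smul]
    have hone : d⁻¹ * (h⁻¹ * g) = 1 :=
      isReflectionHeight_height.eq_one_of_smul_mem_chamber hx (hyx ▸ mem_triangle_iff.1 hy)
    exact inv_mul_eq_one.1 hone ▸ hd
  · rintro _ ⟨y, hy, rfl⟩
    exact mem_patch.2 ⟨_, hd, y, hy, rfl⟩

theorem smul_patch_eq_iff {g h : CoxeterG p q} :
    g • patch D = h • patch D ↔ h⁻¹ * g ∈ D := by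
  refine ⟨fun heq => ?_, fun hd => ?_⟩
  · rw [← smul_triangle_subset_smul_patch, ← heq, smul_triangle_subset_smul_patch, inv_mul_cancel]
    exact one_mem D
  · conv_rhs => rw [← smul_patch_of_mem hd, ← mul_smul, mul_inv_cancel_left]

theorem patch_bot : patch (⊥ : Subgroup (CoxeterG p q)) = triangle p q := by
  simp [patch]

variable (D) in
/-- The tile `⋃ d ∈ D, gdF`, as an element of the tiling. -/
noncomputable def tile (g : CoxeterG p q) : orbitTiling D := ⟨g • patch D, g, rfl⟩

theorem tile_surjective : Function.Surjective (tile D) := by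
  rintro ⟨_, g, rfl⟩
  exact ⟨g, rfl⟩

theorem tile_eq_iff {g h : CoxeterG p q} : tile D g = tile D h ↔ h⁻¹ * g ∈ D :=
  Subtype.ext_iff.trans smul_patch_eq_iff

theorem toPerm_smul_orbitTiling (g : CoxeterG p q) :
    toPerm p q g • orbitTiling D = orbitTiling D :=
  calc toPerm p q g • orbitTiling D = Set.range fun h : CoxeterG p q => (g * h) • patch D := by
        simp only [orbitTiling, Set.smul_set_range, mul_smul]
        rfl
    _ = orbitTiling D := (Equiv.mulLeft g).surjective.range_comp fun h => h • patch D

theorem symmetryGroup_orbitTiling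
    (hD : ∀ f ∈ isometryGroup (curvature p q),
      f • patch D = patch D → f ∈ transformationGroup p q) :
    symmetryGroup (orbitTiling D) = transformationGroup p q := by
  apply le_antisymm
  · rintro f ⟨hf, hfT⟩
    obtain ⟨g, hg⟩ : f • patch D ∈ orbitTiling D := by
      rw [← show f • orbitTiling D = orbitTiling D from hfT]
      exact Set.smul_mem_smul_set ⟨1, one_smul _ _⟩
    have hgf : (toPerm p q g)⁻¹ * f ∈ transformationGroup p q := by
      refine hD _ (mul_mem (inv_mem (toPerm_mem_isometryGroup g)) hf) ?_
      rw [mul_smul, ← hg]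
      exact inv_smul_smul (toPerm p q g) (patch D)
    rw [← mul_inv_cancel_left (toPerm p q g) f]
    exact mul_mem ⟨g, rfl⟩ hgf
  · rintro _ ⟨g, rfl⟩
    exact ⟨toPerm_mem_isometryGroup g, toPerm_smul_orbitTiling g⟩

theorem symmetryGroup_orbitTiling_vertStabilizer (u : Gen) (hu : u = .b → p ≠ q) :
    symmetryGroup (orbitTiling (vertStabilizer p q u)) = transformationGroup p q := by
  obtain ⟨t, htu⟩ := exists_isFarthestVert u hu
  exact symmetryGroup_orbitTiling fun f hf hfP => htu.mem_transformationGroup hf hfP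

theorem symmetryGroup_tilingQP : symmetryGroup (tilingQP p q) = transformationGroup p q := by
  rw [tilingQP, ← vertStabilizer_c]
  exact symmetryGroup_orbitTiling_vertStabilizer _ (by simp)

theorem symmetryGroup_tilingPQ : symmetryGroup (tilingPQ p q) = transformationGroup p q := by
  rw [tilingPQ, ← vertStabilizer_a]
  exact symmetryGroup_orbitTiling_vertStabilizer _ (by simp)

theorem symmetryGroup_tilingLaves (hpq : p ≠ q) :
    symmetryGroup (tilingLaves p q) = transformationGroup p q := by
  rw [tilingLaves, ← vertStabilizer_b]
  exact symmetryGroup_orbitTiling_vertStabilizer _ fun _ => hpq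

end Tiles

section Colourings

variable {p q k : ℕ} [hp : Fact (3 ≤ p)] [hq : Fact (3 ≤ q)] {D S : Subgroup (CoxeterG p q)}

theorem exists_apply_tile_eq (e : CoxeterG p q ⧸ S ≃ Fin k) (hDS : D ≤ S) :
    ∃ d : orbitTiling D → Fin k, ∀ g, d (tile D g) = e (QuotientGroup.mk g) := by
  have : Nonempty (Fin k) := ⟨e (QuotientGroup.mk 1)⟩
  obtain ⟨d, hd⟩ := (Function.factorsThrough_iff fun g => e (QuotientGroup.mk g)).1
    fun g h hgh => congrArg e (QuotientGroup.eq.2 (hDS (tile_eq_iff.1 hgh.symm)))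
  exact ⟨d, fun g => (congrFun hd g).symm⟩

theorem exists_apply_smul_triangle_eq (e : CoxeterG p q ⧸ S ≃ Fin k) :
    ∃ c : triangleTiling p q → Fin k, ∀ g : CoxeterG p q,
      c ⟨g • triangle p q, g, rfl⟩ = e (QuotientGroup.mk g) := by
  obtain ⟨d, hd⟩ := exists_apply_tile_eq e (bot_le : ⊥ ≤ S)
  have hT : triangleTiling p q = orbitTiling ⊥ := by rw [triangleTiling, orbitTiling, patch_bot]
  refine ⟨fun t => d ⟨t.1, hT ▸ t.2⟩, fun g => (congrArg d (Subtype.ext ?_)).trans (hd g)⟩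
  exact congrArg (g • ·) patch_bot.symm

theorem induces_iff {d : orbitTiling D → Fin k} : Induces S d ↔
    D ≤ S ∧ ∃ e : CoxeterG p q ⧸ S ≃ Fin k, ∀ g, d (tile D g) = e (QuotientGroup.mk g) := by
  constructor
  · rintro ⟨c, ⟨e, hc⟩, hcd⟩
    have hcolour {g h : CoxeterG p q} (hd : h⁻¹ * g ∈ D) :
        d (tile D h) = e (QuotientGroup.mk g) := by
      rw [← hc]
      exact (hcd (tile D h) ⟨g • triangle p q, g, rfl⟩
        (smul_triangle_subset_smul_patch.2 hd)).symm
    have hself (g) : d (tile D g) = e (QuotientGroup.mk g) :=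
      hcolour (by rw [inv_mul_cancel]; exact one_mem D)
    refine ⟨fun x hx => ?_, e, hself⟩
    have hone : e (QuotientGroup.mk 1) = e (QuotientGroup.mk x) :=
      (hself 1).symm.trans (hcolour (by rwa [inv_one, one_mul]))
    simpa using QuotientGroup.eq.1 (e.injective hone)
  · rintro ⟨-, e, hd⟩
    obtain ⟨c, hc⟩ := exists_apply_smul_triangle_eq e
    refine ⟨c, ⟨e, hc⟩, ?_⟩
    rintro P ⟨_, g, rfl⟩ hsub
    obtain ⟨h, rfl⟩ := tile_surjective P
    rw [hc, ← hd, tile_eq_iff.2 (smul_triangle_subset_smul_patch.1 hsub)]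

theorem Induces.isPerfectColouring {d : orbitTiling D → Fin k} (h : Induces S d) :
    IsPerfectColouring (transformationGroup p q) d := by
  obtain ⟨-, e, hd⟩ := induces_iff.1 h
  refine ⟨?_, ?_⟩
  · refine Function.Surjective.of_comp (g := tile D) ?_
    rw [show d ∘ tile D = e ∘ QuotientGroup.mk from funext hd]
    exact e.surjective.comp QuotientGroup.mk_surjective
  · rintro _ ⟨g, rfl⟩
    refine ⟨(e.symm.trans (MulAction.toPerm g)).trans e, fun P Q hPQ => ?_⟩
    obtain ⟨h, rfl⟩ := tile_surjective P
    have hQ : Q = tile D (g * h) := Subtype.ext (hPQ.trans (mul_smul g h (patch D)).symm)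
    rw [hQ, hd, hd]
    simp

namespace IsPerfectColouring

variable {d : orbitTiling D → Fin k} (h : IsPerfectColouring (transformationGroup p q) d)

include h

theorem apply_tile_mul_eq_iff (g x y : CoxeterG p q) :
    d (tile D (g * x)) = d (tile D (g * y)) ↔ d (tile D x) = d (tile D y) := by
  obtain ⟨π, hπ⟩ := h.2 (toPerm p q g) ⟨g, rfl⟩
  have hg (x) : d (tile D (g * x)) = π (d (tile D x)) := hπ _ _ (mul_smul g x (patch D))
  rw [hg, hg, π.injective.eq_iff]

/-- The stabiliser of the colour of the tile that contains `F`: the subgroup that induces a given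
perfect colouring. -/
def colourStabilizer : Subgroup (CoxeterG p q) where
  carrier := {g | d (tile D g) = d (tile D 1)}
  one_mem' := rfl
  mul_mem' {x y} hx hy := by
    have hxy := (h.apply_tile_mul_eq_iff x y 1).2 hy
    rw [mul_one] at hxy
    exact hxy.trans hx
  inv_mem' {x} hx := by
    refine (h.apply_tile_mul_eq_iff x x⁻¹ 1).1 ?_
    rw [mul_inv_cancel, mul_one]
    exact hx.symm

theorem apply_tile_eq_iff {x y : CoxeterG p q} :
    d (tile D x) = d (tile D y) ↔ x⁻¹ * y ∈ h.colourStabilizer := by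
  rw [← h.apply_tile_mul_eq_iff x⁻¹, inv_mul_cancel, eq_comm]
  rfl

theorem exists_equiv :
    ∃ e : CoxeterG p q ⧸ h.colourStabilizer ≃ Fin k,
      ∀ g, d (tile D g) = e (QuotientGroup.mk g) := by
  let colour : CoxeterG p q ⧸ h.colourStabilizer → Fin k :=
    Quotient.lift (fun g => d (tile D g)) fun x y hxy =>
      h.apply_tile_eq_iff.2 (QuotientGroup.leftRel_apply.1 hxy)
  have hinj : Function.Injective colour := by
    intro x y
    induction x using QuotientGroup.induction_on with | H x =>
    induction y using QuotientGroup.induction_on with | H y =>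
    exact fun hxy => QuotientGroup.eq.2 (h.apply_tile_eq_iff.1 hxy)
  have hsurj : Function.Surjective colour :=
    Function.Surjective.of_comp (g := QuotientGroup.mk) (h.1.comp tile_surjective)
  exact ⟨Equiv.ofBijective colour ⟨hinj, hsurj⟩, fun _ => rfl⟩

theorem le_colourStabilizer : D ≤ h.colourStabilizer := fun x hx =>
  congrArg d (tile_eq_iff.2 (by rwa [inv_one, one_mul]))

end IsPerfectColouring

theorem isPerfectColouring_iff {d : orbitTiling D → Fin k} :
    IsPerfectColouring (transformationGroup p q) d ↔
      ∃ S : Subgroup (CoxeterG p q), S.index = k ∧ D ≤ S ∧ Induces S d := by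
  refine ⟨fun h => ?_, fun ⟨_, _, _, hS⟩ => hS.isPerfectColouring⟩
  obtain ⟨e, he⟩ := h.exists_equiv
  refine ⟨_, ?_, h.le_colourStabilizer, induces_iff.2 ⟨h.le_colourStabilizer, e, he⟩⟩
  rw [Subgroup.index, Nat.card_congr e, Nat.card_fin]

theorem inducesPerfect_iff (hk : 0 < k) (hS : S.index = k) :
    InducesPerfect k (transformationGroup p q) S (orbitTiling D) ↔ D ≤ S := by
  refine ⟨fun ⟨_, _, hd⟩ => (induces_iff.1 hd).1, fun hDS => ?_⟩
  have hcard : Nat.card (CoxeterG p q ⧸ S) = k := hS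
  have : Finite (CoxeterG p q ⧸ S) := Nat.finite_of_card_ne_zero (hcard ▸ hk.ne')
  let e : CoxeterG p q ⧸ S ≃ Fin k := Finite.equivFinOfCardEq hcard
  obtain ⟨d, hd⟩ := exists_apply_tile_eq e hDS
  have hind : Induces S d := induces_iff.2 ⟨hDS, e, hd⟩
  exact ⟨d, hind.isPerfectColouring, hind⟩

theorem closure_pair_le {G : Type*} [Group G] {x y : G} {H : Subgroup G} :
    Subgroup.closure {x, y} ≤ H ↔ x ∈ H ∧ y ∈ H :=
  (Subgroup.closure_le H).trans Set.pair_subset_iff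

end Colourings

end PerfectColouring

theorem mainTheorem1 (p q k : ℕ) [Fact (3 ≤ p)] [Fact (3 ≤ q)] (hk : 0 < k) :
    -- `G_{p,q}` is the symmetry group of the tilings (of the Laves tiling if `p ≠ q`)
    (symmetryGroup (tilingQP p q) = transformationGroup p q ∧
      symmetryGroup (tilingPQ p q) = transformationGroup p q ∧
      (p ≠ q → symmetryGroup (tilingLaves p q) = transformationGroup p q)) ∧
    -- the subgroups of index `k` that induce perfect `k`-colourings
    (∀ S : Subgroup (CoxeterG p q), S.index = k →
      (InducesPerfect k (transformationGroup p q) S (tilingQP p q) ↔ genA p q ∈ S ∧ genB p q ∈ S) ∧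
      (InducesPerfect k (transformationGroup p q) S (tilingPQ p q) ↔ genB p q ∈ S ∧ genC p q ∈ S) ∧
      (InducesPerfect k (transformationGroup p q) S (tilingLaves p q) ↔
        genA p q ∈ S ∧ genC p q ∈ S)) ∧
    -- the perfect `k`-colourings are the colourings induced by such subgroups
    (∀ d : tilingQP p q → Fin k, IsPerfectColouring (transformationGroup p q) d ↔
      ∃ S : Subgroup (CoxeterG p q), S.index = k ∧ genA p q ∈ S ∧ genB p q ∈ S ∧ Induces S d) ∧
    (∀ d : tilingPQ p q → Fin k, IsPerfectColouring (transformationGroup p q) d ↔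
      ∃ S : Subgroup (CoxeterG p q), S.index = k ∧ genB p q ∈ S ∧ genC p q ∈ S ∧ Induces S d) ∧
    (∀ d : tilingLaves p q → Fin k, IsPerfectColouring (transformationGroup p q) d ↔
      ∃ S : Subgroup (CoxeterG p q), S.index = k ∧ genA p q ∈ S ∧ genC p q ∈ S ∧ Induces S d) ∧
    -- the stabilisers of a vertex, a face centre and an edge midpoint of `(p^q)`
    MulAction.stabilizer (CoxeterG p q) (vertexPoint p q) =
      Subgroup.closure {genA p q, genB p q} ∧
    MulAction.stabilizer (CoxeterG p q) (faceCentre p q) =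
      Subgroup.closure {genB p q, genC p q} ∧
    MulAction.stabilizer (CoxeterG p q) (edgeMidpoint p q) =
      Subgroup.closure {genA p q, genC p q} := by
  refine ⟨⟨symmetryGroup_tilingQP, symmetryGroup_tilingPQ, symmetryGroup_tilingLaves⟩,
    fun S hS => ⟨(inducesPerfect_iff hk hS).trans closure_pair_le,
      (inducesPerfect_iff hk hS).trans closure_pair_le,
      (inducesPerfect_iff hk hS).trans closure_pair_le⟩,
    fun d => ?_, fun d => ?_, fun d => ?_, vertStabilizer_c, vertStabilizer_a, vertStabilizer_b⟩
  all_goals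
    refine isPerfectColouring_iff.trans ?_
    simp only [closure_pair_le, and_assoc]
    exact Iff.rfl
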